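/- Let $n\le m$ be natural numbers, let $\mathbb M_{m,n}$ be the space of real $m\times n$ matrices with inner product $\langle X,Y\rangle=\operatorname{tr}(X^TY)$, and let $\sigma(X)=(\sigma_1(X),\dots,\sigma_n(X))$ be the vector of singular values of $X$ in nonincreasing order. Write $\Sigma(X)=\operatorname{diag}(\sigma(X))\in\mathbb M_{m,n}$, let $\mathcal O^k$ be the set of $k\times k$ real orthogonal matrices, and let $\mathcal O^{m,n}(X)$ be the set of pairs $(U,V)\in\mathcal O^m\times\mathcal O^n$ with $X=U\Sigma(X)V^T$. For a symmetric $k\times k$ matrix $A$, $\lambda(A)$ is the vector of its eigenvalues in nonincreasing order. For a function $g$ with values in $[-\infty,+\infty]$ on a Euclidean space and a point $x$ with $g(x)$ finite, put $$\partial g(x)=\{v:\ g(z)\ge g(x)+\langle v,z-x\rangle\ \text{for all } z\},\qquad \mathrm dg(x)(w)=\liminf_{t\downarrow 0,\ w'\to w}\frac{g(x+tw')-g(x)}{t},$$ and let $K_g(x,v)=\{w:\ \mathrm dg(x)(w)=\langle v,w\rangle\}$ be the critical cone of $g$ at $x$ for $v$; if $g(x)$ is not finite, $\partial g(x)=\emptyset$.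 Let $f:\mathbb R^n\to[-\infty,+\infty]$ be lower semicontinuous, convex (that is, its epigraph is convex) and absolutely symmetric, i.e. $f(Qx)=f(x)$ for every $x\in\mathbb R^n$ and every signed permutation matrix $Q$. Let $X,Y,H\in\mathbb M_{m,n}$ with $Y\in\partial(f\circ\sigma)(X)$, let $r=\operatorname{rank}X$, let $\mu_1>\dots>\mu_t$ be the distinct nonzero singular values of $X$, and put $$\alpha_i=\{s\le r:\ \sigma_s(X)=\mu_i\}\ (i=1,\dots,t),\qquad \beta=\{r+1,\dots,n\},\qquad \hat\beta=\{r+1,\dots,m\}.$$ For a matrix $M$, $M_{IJ}$ is the submatrix with rows in $I$ and columns in $J$; for $U\in\mathcal O^m$ and $V\in\mathcal O^n$, $U_I$ and $V_I$ are the submatrices of the columns with index in $I$. Then $\mathcal O^{m,n}(X)\cap\mathcal O^{m,n}(Y)\neq\emptyset$, the directional derivative $\sigma'(X;H)=\lim_{\tau\downarrow0}\big(\sigma(X+\tau H)-\sigma(X)\big)/\tau$ exists, and for every $(U,V)\in\mathcal O^{m,n}(X)\cap\mathcal O^{m,n}(Y)$ one has $H\in K_{f\circ\sigma}(X,Y)$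 if and only if the following three conditions hold: (1) $\sigma'(X;H)\in K_f(\sigma(X),\sigma(Y))$; (2) for every $i=1,\dots,t$, the matrices $A=\Sigma(Y)_{\alpha_i\alpha_i}$ and $B=\tfrac12\big(U_{\alpha_i}^THV_{\alpha_i}+V_{\alpha_i}^TH^TU_{\alpha_i}\big)$ have a simultaneous ordered spectral decomposition, i.e. there is an orthogonal matrix $P$ with $A=P\operatorname{diag}(\lambda(A))P^T$ and $B=P\operatorname{diag}(\lambda(B))P^T$; (3) the matrices $C=\Sigma(Y)_{\hat\beta\beta}$ and $D=U_{\hat\beta}^THV_\beta$ have a simultaneous ordered singular value decomposition, i.e. there are orthogonal matrices $P,Q$ with $C=P\,\Sigma(C)\,Q^T$ and $D=P\,\Sigma(D)\,Q^T$. -/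

import Mathlib

open Filter Topology Matrix

namespace CritCone

/-! ### Variational analysis of extended-real-valued functions -/

section Variational

variable {E : Type*}

/-- The epigraph of `g`. -/
def epigraph (g : E → EReal) : Set (E × ℝ) := {p | g p.1 ≤ (p.2 : EReal)}

/-- The subdifferential (in the sense of convex analysis) of `g` at `x` with respect to the
inner product `ip`; it is empty where `g` is not finite. -/
def subdifferential [AddCommGroup E] (ip : E → E → ℝ) (g : E → EReal) (x : E) : Set E :=
  {v | g x ≠ ⊥ ∧ g x ≠ ⊤ ∧ ∀ z, g x + (ip v (z - x) : EReal) ≤ g z}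

/-- The subderivative: the lower limit of `(g (x + t w') - g x) / t` as `t ↓ 0`, `w' → w`
(used at points where `g x` is finite). -/
noncomputable def subderivative [AddCommGroup E] [Module ℝ E] [TopologicalSpace E]
    (g : E → EReal) (x w : E) : EReal :=
  liminf (fun p : ℝ × E => (g (x + p.1 • p.2) - g x) / (p.1 : EReal)) (𝓝[>] (0 : ℝ) ×ˢ 𝓝 w)

/-- The critical cone of `g` at `x` for `v` with respect to the inner product `ip`. -/
def criticalCone [AddCommGroup E] [Module ℝ E] [TopologicalSpace E]
    (ip : E → E → ℝ) (g : E → EReal) (x v : E) : Set E :=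
  {w | subderivative g x w = (ip v w : EReal)}

/-- `d` is the (one-sided) directional derivative of `φ` at `x` in the direction `w`. -/
def HasDirDeriv {F : Type*} [AddCommGroup E] [Module ℝ E] [AddCommGroup F] [Module ℝ F]
    [TopologicalSpace F] (φ : E → F) (x w : E) (d : F) : Prop :=
  Tendsto (fun t : ℝ => t⁻¹ • (φ (x + t • w) - φ x)) (𝓝[>] (0 : ℝ)) (𝓝 d)

end Variational

/-! ### Absolutely symmetric functions -/

/-- Signed permutation matrices. -/
def IsSignedPerm {n : ℕ} (Q : Matrix (Fin n) (Fin n) ℝ) : Prop :=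
  (∀ i j, Q i j = 0 ∨ Q i j = 1 ∨ Q i j = -1) ∧
    (∀ i, ∃! j, Q i j ≠ 0) ∧ (∀ j, ∃! i, Q i j ≠ 0)

/-- Absolutely symmetric functions: invariant under all signed permutation matrices. -/
def AbsolutelySymmetric {n : ℕ} (f : (Fin n → ℝ) → EReal) : Prop :=
  ∀ (x : Fin n → ℝ) (Q : Matrix (Fin n) (Fin n) ℝ), IsSignedPerm Q → f (Q *ᵥ x) = f x

/-! ### Eigenvalues and singular values -/

/-- The trace inner product `tr (Xᵀ Y)`. -/
def matInner {m n : ℕ} (X Y : Matrix (Fin m) (Fin n) ℝ) : ℝ := (Xᵀ * Y).trace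

/-- The eigenvalues of a real symmetric matrix in nonincreasing order, with multiplicity
(the zero vector if `A` is not symmetric). -/
noncomputable def eigs {k : ℕ} (A : Matrix (Fin k) (Fin k) ℝ) : Fin k → ℝ :=
  open Classical in
  if hA : A.IsHermitian then fun i => hA.eigenvalues₀ (Fin.cast (Fintype.card_fin k).symm i)
  else 0

/-- The `n` singular values of an `m × n` matrix in nonincreasing order, with multiplicity. -/
noncomputable def sing {m n : ℕ} (X : Matrix (Fin m) (Fin n) ℝ) : Fin n → ℝ :=
  fun j => (Matrix.toEuclideanLin X).singularValues j

/-- The rectangular `m × n` matrix with diagonal `d`. -/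
def rdiag (m : ℕ) {n : ℕ} (d : Fin n → ℝ) : Matrix (Fin m) (Fin n) ℝ :=
  Matrix.of fun i j => if (i : ℕ) = (j : ℕ) then d j else 0

/-- `Σ(X)`, the `m × n` diagonal matrix of the ordered singular values of `X`. -/
noncomputable def Sig {m n : ℕ} (X : Matrix (Fin m) (Fin n) ℝ) : Matrix (Fin m) (Fin n) ℝ :=
  rdiag m (sing X)

/-- The set of pairs `(U, V)` of orthogonal matrices with `X = U Σ(X) Vᵀ`. -/
def svdPairs {m n : ℕ} (X : Matrix (Fin m) (Fin n) ℝ) :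
    Set (Matrix (Fin m) (Fin m) ℝ × Matrix (Fin n) (Fin n) ℝ) :=
  {p | p.1 ∈ Matrix.orthogonalGroup (Fin m) ℝ ∧ p.2 ∈ Matrix.orthogonalGroup (Fin n) ℝ ∧
    X = p.1 * Sig X * p.2ᵀ}

/-- `A` and `B` have a simultaneous ordered singular value decomposition. -/
def SimulOrderedSVD {m n : ℕ} (A B : Matrix (Fin m) (Fin n) ℝ) : Prop :=
  (svdPairs A ∩ svdPairs B).Nonempty

/-- `A` and `B` have a simultaneous ordered spectral decomposition. -/
def SimulOrderedSpectral {k : ℕ} (A B : Matrix (Fin k) (Fin k) ℝ) : Prop :=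
  ∃ U ∈ Matrix.orthogonalGroup (Fin k) ℝ,
    A = U * Matrix.diagonal (eigs A) * Uᵀ ∧ B = U * Matrix.diagonal (eigs B) * Uᵀ

/-! ### Index sets and blocks (indices start from `0`) -/

/-- The increasing enumeration of an index set. -/
def enum {p : ℕ} (I : Finset (Fin p)) : Fin I.card → Fin p := I.orderEmbOfFin rfl

/-- The index set `{s : s ≤ rank X, σ_s(X) = c}`; for a nonzero singular value `c = μ_i` this
is `α_i`. -/
noncomputable def alphaIdx {m n : ℕ} (X : Matrix (Fin m) (Fin n) ℝ) (c : ℝ) : Finset (Fin n) :=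
  Finset.univ.filter fun s => (s : ℕ) < X.rank ∧ sing X s = c

/-- `β = {r + 1, …, n}`, where `r = rank X`. -/
noncomputable def betaIdx {m n : ℕ} (X : Matrix (Fin m) (Fin n) ℝ) : Finset (Fin n) :=
  Finset.univ.filter fun s => X.rank ≤ (s : ℕ)

/-- `β̂ = {r + 1, …, m}`, where `r = rank X`. -/
noncomputable def betaHatIdx {m n : ℕ} (X : Matrix (Fin m) (Fin n) ℝ) : Finset (Fin m) :=
  Finset.univ.filter fun s => X.rank ≤ (s : ℕ)

/-- Enumeration of a set of column indices, viewed as row indices (`n ≤ m`). -/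
def rowEnum {m n : ℕ} (hmn : n ≤ m) (I : Finset (Fin n)) : Fin I.card → Fin m :=
  Fin.castLE hmn ∘ enum I

/-- The submatrix `M_J` consisting of the columns listed by `e`. -/
def cols {p q k : ℕ} (M : Matrix (Fin p) (Fin q) ℝ) (e : Fin k → Fin q) :
    Matrix (Fin p) (Fin k) ℝ := M.submatrix id e

/-- The symmetrized block `½ (U_Iᵀ H V_I + V_Iᵀ Hᵀ U_I)`. -/
noncomputable def symBlock {m n : ℕ} (hmn : n ≤ m) (U : Matrix (Fin m) (Fin m) ℝ)
    (V : Matrix (Fin n) (Fin n) ℝ) (H : Matrix (Fin m) (Fin n) ℝ) (I : Finset (Fin n)) :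
    Matrix (Fin I.card) (Fin I.card) ℝ :=
  (1 / 2 : ℝ) • ((cols U (rowEnum hmn I))ᵀ * H * cols V (enum I) +
    (cols V (enum I))ᵀ * Hᵀ * cols U (rowEnum hmn I))

end CritCone

namespace CritCone

/-! ### The von Neumann trace inequality -/

/-! Write `d = σ'(X; H)`. Everything rests on the chain `df(σ(X))(d) ≥ ⟨σ(Y), d⟩ ≥ ⟨Y, H⟩`. By the
chain rule `subderivative_comp_sing` the left end is the subderivative of `f ∘ σ` at `X` along `H`,
so criticality of `H` means that the two ends agree, hence that both inequalities are equalities.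
Equality in the first is condition (1); equality in the second is (2) together with (3).

The first inequality holds because `σ(Y)` is a subgradient of `f` at `σ(X)`. This comes from
`subdifferential_comp_sing`: the subgradient inequality, tested at a matrix with the singular values
of `X` and the singular vectors of `Y`, forces equality in von Neumann's trace inequality for `X`
and `Y`. The equality case `simulOrderedSVD_of_matInner_eq` then yields a common decomposition.

The second inequality (`matInner_le_and_eq_iff`) splits along the blocks of equal singular values of
`X`. The entries of `d` over `α_i` are the eigenvalues of the symmetrized block of `Uᵀ H V`, and
those over `β` are the singular values of its `β̂ × β` block (`IsSpectralDerivative.blocks`). Fan's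
inequality applies on each `α_i` and von Neumann's on `β`, and the equality cases are the
simultaneous ordered decompositions.

The derivative `d` exists by compactness. Along any ultrafilter tending to `0` from the right, the
decompositions of `X + tH` converge to one of `X`; comparing terms of order `t` identifies the limit
of the difference quotients through the blocks, so it does not depend on the ultrafilter. -/

theorem sum_mul_nonneg_of_prefix_nonneg {n : ℕ} (a g : Fin n → ℝ) (ha : Antitone a)
    (ha0 : ∀ i, 0 ≤ a i) (hg : ∀ k, 0 ≤ ∑ i, if i ≤ k then g i else 0) :
    0 ≤ ∑ i, a i * g i := by
  induction n with
  | zero => simp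
  | succ n ih =>
    -- Abel summation: subtracting the last coefficient from all the others leaves a shorter
    -- nonincreasing nonnegative sequence, and what is removed is that coefficient times the full
    -- sum of `g`.
    have h1 := ih (fun i => a i.castSucc - a (Fin.last n)) (fun i => g i.castSucc)
      (fun i j hij => by
        have := ha (Fin.castSucc_le_castSucc_iff.mpr hij)
        simp only
        linarith)
      (fun i => sub_nonneg.mpr (ha (Fin.le_last _)))
      (fun k => by
        have := hg k.castSucc
        rw [Fin.sum_univ_castSucc] at this
        simpa [Fin.castSucc_le_castSucc_iff, Fin.last_le_iff, Fin.castSucc_ne_last] using this)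
    have h2 := hg (Fin.last n)
    simp only [Fin.le_last, if_true] at h2
    have h3 := mul_nonneg (ha0 (Fin.last n)) h2
    rw [Fin.sum_univ_castSucc] at h3 ⊢
    simp only [sub_mul, Finset.sum_sub_distrib, ← Finset.mul_sum] at h1
    linarith

/-- Two Abel summations reduce `a` and `b` to indicators of initial segments. There the claim is
that the mass of `M` on an initial `k × l` block is at most the smaller side of the block. -/
theorem sum_mul_substochastic_le {n : ℕ} (a b : Fin n → ℝ) (M : Fin n → Fin n → ℝ)
    (ha : Antitone a) (ha0 : ∀ i, 0 ≤ a i) (hb : Antitone b) (hb0 : ∀ i, 0 ≤ b i)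
    (hM : ∀ i j, 0 ≤ M i j) (hrow : ∀ i, ∑ j, M i j ≤ 1) (hcol : ∀ j, ∑ i, M i j ≤ 1) :
    ∑ i, ∑ j, a i * b j * M i j ≤ ∑ i, a i * b i := by
  have key : 0 ≤ ∑ i, a i * (b i - ∑ j, b j * M i j) := by
    refine sum_mul_nonneg_of_prefix_nonneg _ _ ha ha0 fun k => ?_
    have h2 : 0 ≤ ∑ j, b j * ((if j ≤ k then 1 else 0) - ∑ i, if i ≤ k then M i j else 0) := by
      refine sum_mul_nonneg_of_prefix_nonneg _ _ hb hb0 fun l => ?_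
      have e : ∀ j : Fin n, (if j ≤ l then ((if j ≤ k then (1 : ℝ) else 0) -
          ∑ i, if i ≤ k then M i j else 0) else 0) =
          (if j ≤ l then (if j ≤ k then (1 : ℝ) else 0) else 0) -
          (if j ≤ l then ∑ i, (if i ≤ k then M i j else 0) else 0) := by
        intro j; split_ifs <;> simp
      simp only [e, Finset.sum_sub_distrib, sub_nonneg]
      -- The row sums bound the block when it has fewer rows, the column sums when it has fewer
      -- columns.
      rcases le_total k l with hkl | hkl
      · calc ∑ j, (if j ≤ l then ∑ i, (if i ≤ k then M i j else 0) else 0)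
            ≤ ∑ j, ∑ i, (if i ≤ k then M i j else 0) := by
              refine Finset.sum_le_sum fun j _ => ?_
              split_ifs
              · exact le_rfl
              · exact Finset.sum_nonneg fun i _ => by split_ifs <;> simp [hM]
          _ = ∑ i, if i ≤ k then ∑ j, M i j else 0 := by
              rw [Finset.sum_comm]
              refine Finset.sum_congr rfl fun i _ => ?_
              split_ifs <;> simp
          _ ≤ ∑ i, if i ≤ k then 1 else 0 := by
              refine Finset.sum_le_sum fun i _ => ?_
              split_ifs
              · exact hrow i
              · exact le_rfl
          _ ≤ _ := by
              refine Finset.sum_le_sum fun i _ => ?_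
              by_cases h : i ≤ k
              · simp [h, h.trans hkl]
              · simp [h]
      · refine Finset.sum_le_sum fun j _ => ?_
        by_cases h : j ≤ l
        · simp only [h, h.trans hkl, if_true]
          refine le_trans (Finset.sum_le_sum fun i _ => ?_) (hcol j)
          split_ifs
          · exact le_rfl
          · exact hM i j
        · simp [h]
    refine h2.trans_eq ?_
    have e1 : ∑ j, b j * ∑ i, (if i ≤ k then M i j else 0) =
        ∑ i, if i ≤ k then ∑ j, b j * M i j else 0 := by
      simp only [Finset.mul_sum]
      rw [Finset.sum_comm]
      refine Finset.sum_congr rfl fun i _ => ?_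
      split_ifs <;> simp
    simp only [mul_sub, Finset.sum_sub_distrib, e1]
    rw [← Finset.sum_sub_distrib]
    refine Finset.sum_congr rfl fun i _ => ?_
    split_ifs <;> simp
  have e : ∑ i, a i * (b i - ∑ j, b j * M i j) =
      ∑ i, a i * b i - ∑ i, ∑ j, a i * b j * M i j := by
    rw [← Finset.sum_sub_distrib]
    refine Finset.sum_congr rfl fun i _ => ?_
    rw [mul_sub, Finset.mul_sum]
    simp only [mul_assoc]
  linarith

theorem mem_orthogonalGroup_iff_mul_transpose {k : ℕ} {U : Matrix (Fin k) (Fin k) ℝ} :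
    U ∈ Matrix.orthogonalGroup (Fin k) ℝ ↔ U * Uᵀ = 1 :=
  Matrix.mem_orthogonalGroup_iff (Fin k) ℝ

theorem mem_orthogonalGroup_iff_transpose_mul {k : ℕ} {U : Matrix (Fin k) (Fin k) ℝ} :
    U ∈ Matrix.orthogonalGroup (Fin k) ℝ ↔ Uᵀ * U = 1 :=
  Matrix.mem_orthogonalGroup_iff' (Fin k) ℝ

theorem transpose_mem_orthogonalGroup {k : ℕ} {U : Matrix (Fin k) (Fin k) ℝ}
    (hU : U ∈ Matrix.orthogonalGroup (Fin k) ℝ) : Uᵀ ∈ Matrix.orthogonalGroup (Fin k) ℝ := by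
  rw [mem_orthogonalGroup_iff_mul_transpose, transpose_transpose]
  exact mem_orthogonalGroup_iff_transpose_mul.mp hU

theorem sum_row_sq_of_orthogonal {k : ℕ} {U : Matrix (Fin k) (Fin k) ℝ}
    (hU : U ∈ Matrix.orthogonalGroup (Fin k) ℝ) (i : Fin k) : ∑ j, U i j ^ 2 = 1 := by
  have := congrFun (congrFun (mem_orthogonalGroup_iff_mul_transpose.mp hU) i) i
  simpa [mul_apply, sq] using this

theorem sum_col_sq_of_orthogonal {k : ℕ} {U : Matrix (Fin k) (Fin k) ℝ}
    (hU : U ∈ Matrix.orthogonalGroup (Fin k) ℝ) (j : Fin k) : ∑ i, U i j ^ 2 = 1 :=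
  sum_row_sq_of_orthogonal (transpose_mem_orthogonalGroup hU) j

/-! ### The trace inner product and rectangular diagonal matrices. -/

section MatInner

variable {m n : ℕ}

theorem matInner_eq_sum (X Y : Matrix (Fin m) (Fin n) ℝ) :
    matInner X Y = ∑ i, ∑ j, X i j * Y i j := by
  simp only [matInner, trace, diag_apply, mul_apply, transpose_apply]
  exact Finset.sum_comm

theorem matInner_comm (X Y : Matrix (Fin m) (Fin n) ℝ) : matInner X Y = matInner Y X := by
  simp only [matInner_eq_sum, mul_comm]

theorem matInner_add_left (X Y Z : Matrix (Fin m) (Fin n) ℝ) :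
    matInner (X + Y) Z = matInner X Z + matInner Y Z := by
  simp [matInner, Matrix.add_mul]

theorem matInner_add_right (X Y Z : Matrix (Fin m) (Fin n) ℝ) :
    matInner X (Y + Z) = matInner X Y + matInner X Z := by
  simp [matInner, Matrix.mul_add]

theorem matInner_sub_left (X Y Z : Matrix (Fin m) (Fin n) ℝ) :
    matInner (X - Y) Z = matInner X Z - matInner Y Z := by
  simp [matInner, Matrix.sub_mul]

theorem matInner_sub_right (X Y Z : Matrix (Fin m) (Fin n) ℝ) :
    matInner X (Y - Z) = matInner X Y - matInner X Z := by
  simp [matInner, Matrix.mul_sub]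

theorem matInner_smul_right (c : ℝ) (X Y : Matrix (Fin m) (Fin n) ℝ) :
    matInner X (c • Y) = c * matInner X Y := by
  simp [matInner]

theorem sq_apply_le_matInner_self (X : Matrix (Fin m) (Fin n) ℝ) (i : Fin m) (j : Fin n) :
    X i j ^ 2 ≤ matInner X X := by
  rw [matInner_eq_sum, sq]
  refine le_trans ?_ (Finset.single_le_sum (f := fun i => ∑ j, X i j * X i j)
    (fun i _ => Finset.sum_nonneg fun j _ => mul_self_nonneg _) (Finset.mem_univ i))
  exact Finset.single_le_sum (f := fun j => X i j * X i j)
    (fun j _ => mul_self_nonneg _) (Finset.mem_univ j)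

theorem eq_of_matInner_sub_self {X Y : Matrix (Fin m) (Fin n) ℝ}
    (h : matInner (X - Y) (X - Y) ≤ 0) : X = Y := by
  ext i j
  have := (sq_apply_le_matInner_self (X - Y) i j).trans h
  have h2 := pow_eq_zero_iff (two_ne_zero) |>.mp (le_antisymm this (sq_nonneg _))
  exact sub_eq_zero.mp h2

theorem matInner_mul_mul (U : Matrix (Fin m) (Fin m) ℝ) (V : Matrix (Fin n) (Fin n) ℝ)
    (A B : Matrix (Fin m) (Fin n) ℝ) :
    matInner (U * A * Vᵀ) B = matInner A (Uᵀ * B * V) := by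
  simp only [matInner, transpose_mul, transpose_transpose]
  rw [Matrix.mul_assoc, Matrix.trace_mul_comm]
  simp only [Matrix.mul_assoc]

theorem matInner_conj_self {U : Matrix (Fin m) (Fin m) ℝ} {V : Matrix (Fin n) (Fin n) ℝ}
    (hU : U ∈ Matrix.orthogonalGroup (Fin m) ℝ) (hV : V ∈ Matrix.orthogonalGroup (Fin n) ℝ)
    (A B : Matrix (Fin m) (Fin n) ℝ) :
    matInner (U * A * Vᵀ) (U * B * Vᵀ) = matInner A B := by
  rw [matInner_mul_mul]
  congr 1
  have h1 := mem_orthogonalGroup_iff_transpose_mul.mp hU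
  have h2 := mem_orthogonalGroup_iff_transpose_mul.mp hV
  calc Uᵀ * (U * B * Vᵀ) * V = (Uᵀ * U) * B * (Vᵀ * V) := by simp only [Matrix.mul_assoc]
    _ = B := by rw [h1, h2, Matrix.one_mul, Matrix.mul_one]

theorem matInner_rdiag_left (hmn : n ≤ m) (a : Fin n → ℝ) (B : Matrix (Fin m) (Fin n) ℝ) :
    matInner (rdiag m a) B = ∑ i, a i * B (Fin.castLE hmn i) i := by
  rw [matInner_eq_sum, Finset.sum_comm]
  refine Finset.sum_congr rfl fun j _ => ?_
  rw [Finset.sum_eq_single (Fin.castLE hmn j)]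
  · simp [rdiag]
  · intro i _ hi
    have : (i : ℕ) ≠ j := fun h => hi (Fin.ext h)
    simp [rdiag, this]
  · simp

theorem rdiag_castLE (hmn : n ≤ m) (a : Fin n → ℝ) (i j : Fin n) :
    rdiag m a (Fin.castLE hmn i) j = if i = j then a j else 0 := by
  simp [rdiag, Fin.ext_iff]

theorem matInner_rdiag_rdiag (hmn : n ≤ m) (a b : Fin n → ℝ) :
    matInner (rdiag m a) (rdiag m b) = a ⬝ᵥ b := by
  rw [matInner_rdiag_left hmn]
  simp [rdiag_castLE, dotProduct]

theorem mul_rdiag_apply (hmn : n ≤ m) {p : ℕ} (A : Matrix (Fin p) (Fin m) ℝ) (a : Fin n → ℝ)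
    (i : Fin p) (j : Fin n) :
    (A * rdiag m a) i j = A i (Fin.castLE hmn j) * a j := by
  rw [mul_apply, Finset.sum_eq_single (Fin.castLE hmn j)]
  · simp [rdiag]
  · intro k _ hk
    have : (k : ℕ) ≠ j := fun h => hk (Fin.ext h)
    simp [rdiag, this]
  · simp

theorem rdiag_mul_apply_castLE (hmn : n ≤ m) {p : ℕ} (B : Matrix (Fin n) (Fin p) ℝ)
    (a : Fin n → ℝ) (i : Fin n) (j : Fin p) :
    (rdiag m a * B) (Fin.castLE hmn i) j = a i * B i j := by
  rw [mul_apply, Finset.sum_eq_single i]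
  · simp [rdiag]
  · intro k _ hk
    rw [rdiag_castLE, if_neg (Ne.symm hk), zero_mul]
  · simp

/-- Von Neumann's trace inequality for matrices given by singular value decompositions. -/
theorem matInner_svd_le (hmn : n ≤ m) {U U' : Matrix (Fin m) (Fin m) ℝ}
    {V V' : Matrix (Fin n) (Fin n) ℝ}
    (hU : U ∈ Matrix.orthogonalGroup (Fin m) ℝ) (hV : V ∈ Matrix.orthogonalGroup (Fin n) ℝ)
    (hU' : U' ∈ Matrix.orthogonalGroup (Fin m) ℝ) (hV' : V' ∈ Matrix.orthogonalGroup (Fin n) ℝ)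
    {a b : Fin n → ℝ} (ha : Antitone a) (ha0 : ∀ i, 0 ≤ a i) (hb : Antitone b)
    (hb0 : ∀ i, 0 ≤ b i) :
    matInner (U * rdiag m a * Vᵀ) (U' * rdiag m b * V'ᵀ) ≤ a ⬝ᵥ b := by
  set ι := Fin.castLE hmn
  set P := Uᵀ * U'
  set Q := Vᵀ * V'
  have hP : P ∈ Matrix.orthogonalGroup (Fin m) ℝ := mul_mem (transpose_mem_orthogonalGroup hU) hU'
  have hQ : Q ∈ Matrix.orthogonalGroup (Fin n) ℝ := mul_mem (transpose_mem_orthogonalGroup hV) hV'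
  have e1 : Uᵀ * (U' * rdiag m b * V'ᵀ) * V = P * rdiag m b * Qᵀ := by
    simp only [P, Q, transpose_mul, transpose_transpose, Matrix.mul_assoc]
  rw [matInner_mul_mul, e1, matInner_rdiag_left hmn]
  have hι : Function.Injective ι := Fin.castLE_injective hmn
  have hsub : ∀ g : Fin m → ℝ, (∀ i, 0 ≤ g i) → ∑ j, g (ι j) ≤ ∑ i, g i := fun g hg => by
    rw [← Finset.sum_image (f := g) (s := Finset.univ) (g := ι) (fun _ _ _ _ h => hι h)]
    exact Finset.sum_le_sum_of_subset_of_nonneg (Finset.subset_univ _) fun i _ _ => hg i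
  calc ∑ i, a i * (P * rdiag m b * Qᵀ) (ι i) i
      = ∑ i, ∑ j, a i * b j * (P (ι i) (ι j) * Q i j) := by
        refine Finset.sum_congr rfl fun i _ => ?_
        rw [mul_apply, Finset.mul_sum]
        refine Finset.sum_congr rfl fun j _ => ?_
        rw [mul_rdiag_apply hmn, transpose_apply]
        ring
    -- The averaged squares of the entries of two orthogonal matrices have row and column sums at
    -- most 1. They may be smaller than 1 because only `n` of the `m` rows and columns of `P` enter.
    _ ≤ ∑ i, ∑ j, a i * b j * ((P (ι i) (ι j) ^ 2 + Q i j ^ 2) / 2) := by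
        refine Finset.sum_le_sum fun i _ => Finset.sum_le_sum fun j _ => ?_
        refine mul_le_mul_of_nonneg_left ?_ (mul_nonneg (ha0 i) (hb0 j))
        nlinarith [sq_nonneg (P (ι i) (ι j) - Q i j)]
    _ ≤ ∑ i, a i * b i := by
        refine sum_mul_substochastic_le a b _ ha ha0 hb hb0 (fun i j => by positivity)
          (fun i => ?_) fun j => ?_
        · rw [← Finset.sum_div, Finset.sum_add_distrib, sum_row_sq_of_orthogonal hQ]
          have := (hsub (fun k => P (ι i) k ^ 2) fun _ => sq_nonneg _).trans_eq
            (sum_row_sq_of_orthogonal hP (ι i))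
          linarith
        · rw [← Finset.sum_div, Finset.sum_add_distrib, sum_col_sq_of_orthogonal hQ]
          have := (hsub (fun k => P k (ι j) ^ 2) fun _ => sq_nonneg _).trans_eq
            (sum_col_sq_of_orthogonal hP (ι j))
          linarith

theorem rdiag_transpose_mul_self (hmn : n ≤ m) (a : Fin n → ℝ) :
    (rdiag m a)ᵀ * rdiag m a = diagonal fun i => a i ^ 2 := by
  ext i j
  rw [mul_rdiag_apply hmn, transpose_apply, rdiag_castLE, diagonal_apply]
  by_cases h : i = j
  · subst h; simp [sq]
  · simp [h, Ne.symm h]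

theorem rdiag_square (a : Fin n → ℝ) : rdiag n a = diagonal a := by
  ext i j
  by_cases h : i = j
  · subst h; simp [rdiag]
  · simp [rdiag, h, ← Fin.ext_iff]

/-- Uniqueness of the ordered nonnegative spectrum. -/
theorem eq_of_conj_diagonal_eq {W W' : Matrix (Fin n) (Fin n) ℝ}
    (hW : W ∈ Matrix.orthogonalGroup (Fin n) ℝ) (hW' : W' ∈ Matrix.orthogonalGroup (Fin n) ℝ)
    {a b : Fin n → ℝ} (ha : Antitone a) (ha0 : ∀ i, 0 ≤ a i) (hb : Antitone b)
    (hb0 : ∀ i, 0 ≤ b i) (h : W * diagonal a * Wᵀ = W' * diagonal b * W'ᵀ) : a = b := by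
  simp only [← rdiag_square] at h
  have h1 := matInner_svd_le le_rfl hW hW hW' hW' ha ha0 hb hb0
  have h2 := matInner_conj_self hW hW (rdiag n a) (rdiag n a)
  have h3 := matInner_conj_self hW' hW' (rdiag n b) (rdiag n b)
  rw [← h, matInner_rdiag_rdiag le_rfl] at h3
  rw [matInner_rdiag_rdiag le_rfl] at h2
  rw [← h] at h1
  -- Both `a ⬝ᵥ a` and `b ⬝ᵥ b` are the squared norm of the common matrix, which the trace
  -- inequality bounds by `a ⬝ᵥ b`.
  have h4 : (a - b) ⬝ᵥ (a - b) ≤ 0 := by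
    rw [sub_dotProduct, dotProduct_sub, dotProduct_sub, dotProduct_comm b a]
    linarith
  have h5 : (a - b) ⬝ᵥ (a - b) = 0 :=
    le_antisymm h4 (Finset.sum_nonneg fun i _ => mul_self_nonneg _)
  exact sub_eq_zero.mp (dotProduct_self_eq_zero.mp h5)

end MatInner

/-! ### Existence and uniqueness of ordered decompositions -/

theorem orthonormalBasis_matrix_mem_orthogonalGroup {k : ℕ}
    (b : OrthonormalBasis (Fin k) ℝ (EuclideanSpace ℝ (Fin k))) :
    (Matrix.of fun i j => b j i) ∈ Matrix.orthogonalGroup (Fin k) ℝ := by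
  rw [mem_orthogonalGroup_iff_transpose_mul]
  ext i j
  have := orthonormal_iff_ite.mp b.orthonormal i j
  rw [PiLp.inner_apply] at this
  simp only [mul_apply, transpose_apply, of_apply, one_apply]
  rw [← this]
  refine Finset.sum_congr rfl fun x _ => ?_
  simp [mul_comm]

theorem eigs_antitone {k : ℕ} (A : Matrix (Fin k) (Fin k) ℝ) : Antitone (eigs A) := by
  classical
  by_cases hA : A.IsHermitian
  · intro i j hij
    simp only [eigs, hA, dif_pos]
    exact hA.eigenvalues₀_antitone (by simpa using hij)
  · intro i j _
    rw [eigs, dif_neg hA]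
    exact le_rfl

theorem exists_orthogonal_diagonal_eigs {k : ℕ} {A : Matrix (Fin k) (Fin k) ℝ} (hA : Aᵀ = A) :
    ∃ W ∈ Matrix.orthogonalGroup (Fin k) ℝ, A = W * diagonal (eigs A) * Wᵀ := by
  classical
  have hA' : A.IsHermitian := by
    rw [Matrix.IsHermitian, conjTranspose_eq_transpose_of_trivial, hA]
  have hT := isSymmetric_toEuclideanLin_iff.mpr hA'
  have hn : Module.finrank ℝ (EuclideanSpace ℝ (Fin k)) = Fintype.card (Fin k) :=
    finrank_euclideanSpace
  set b := (hT.eigenvectorBasis hn).reindex (finCongr (Fintype.card_fin k)) with hb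
  have hW := orthonormalBasis_matrix_mem_orthogonalGroup b
  set W : Matrix (Fin k) (Fin k) ℝ := Matrix.of fun i j => b j i with hWdef
  refine ⟨W, hW, ?_⟩
  have hAW : A * W = W * diagonal (eigs A) := by
    ext i j
    have h1 := hT.apply_eigenvectorBasis hn (Fin.cast (Fintype.card_fin k).symm j)
    have h2 := congrArg (fun v : EuclideanSpace ℝ (Fin k) => v i) h1
    have h3 : (A * W) i j = (A *ᵥ (b j).ofLp) i := rfl
    have h4 : b j = hT.eigenvectorBasis hn (Fin.cast (Fintype.card_fin k).symm j) := by
      simp [hb]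
    rw [h3, mul_diagonal, h4]
    change (A *ᵥ (hT.eigenvectorBasis hn (Fin.cast (Fintype.card_fin k).symm j)).ofLp) i = _ at h2
    rw [h2]
    simp only [eigs, hA', dif_pos, IsHermitian.eigenvalues₀, hWdef, of_apply, h4]
    simp [mul_comm]
  rw [← hAW, Matrix.mul_assoc, mem_orthogonalGroup_iff_mul_transpose.mp hW, Matrix.mul_one]

section Sing

variable {m n : ℕ}

theorem sing_antitone (X : Matrix (Fin m) (Fin n) ℝ) : Antitone (sing X) := fun _ _ hij =>
  LinearMap.singularValues_antitone _ hij

theorem sing_nonneg (X : Matrix (Fin m) (Fin n) ℝ) (i : Fin n) : 0 ≤ sing X i :=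
  LinearMap.singularValues_nonneg _ _

theorem sing_eq_zero_iff (X : Matrix (Fin m) (Fin n) ℝ) (i : Fin n) :
    sing X i = 0 ↔ X.rank ≤ i := by
  rw [sing, LinearMap.singularValues_eq_zero_iff_le_finrank_range,
    Matrix.rank_eq_finrank_range_toLin X (EuclideanSpace.basisFun _ ℝ).toBasis
      (EuclideanSpace.basisFun _ ℝ).toBasis, toEuclideanLin_eq_toLin_orthonormal]

theorem exists_gram_eq_sing_sq (X : Matrix (Fin m) (Fin n) ℝ) :
    ∃ W ∈ Matrix.orthogonalGroup (Fin n) ℝ,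
      Xᵀ * X = W * diagonal (fun i => sing X i ^ 2) * Wᵀ := by
  classical
  set T := Matrix.toEuclideanLin X with hTdef
  have hT := T.isSymmetric_adjoint_comp_self
  have hn : Module.finrank ℝ (EuclideanSpace ℝ (Fin n)) = n := finrank_euclideanSpace_fin
  set b := hT.eigenvectorBasis hn with hb
  have hW := orthonormalBasis_matrix_mem_orthogonalGroup b
  set W : Matrix (Fin n) (Fin n) ℝ := Matrix.of fun i j => b j i with hWdef
  refine ⟨W, hW, ?_⟩
  have hAW : Xᵀ * X * W = W * diagonal (fun i => sing X i ^ 2) := by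
    ext i j
    have h1 := hT.apply_eigenvectorBasis hn j
    rw [← T.sq_singularValues_fin hn j] at h1
    have h2 := congrArg (fun v : EuclideanSpace ℝ (Fin n) => v i) h1
    have h3 : (Xᵀ * X * W) i j = ((Xᵀ * X) *ᵥ (b j).ofLp) i := rfl
    have hadj : LinearMap.adjoint T = Matrix.toEuclideanLin Xᵀ := by
      rw [hTdef, ← Matrix.toEuclideanLin_conjTranspose_eq_adjoint,
        conjTranspose_eq_transpose_of_trivial]
    have h5 : ∀ w : EuclideanSpace ℝ (Fin n),
        ((LinearMap.adjoint T ∘ₗ T) w).ofLp = (Xᵀ * X) *ᵥ w.ofLp := fun w => by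
      rw [LinearMap.comp_apply, hadj]
      change Xᵀ *ᵥ (X *ᵥ w.ofLp) = _
      rw [mulVec_mulVec]
    rw [h3, mul_diagonal, hb, ← h5, h2]
    simp only [PiLp.smul_apply, smul_eq_mul, hWdef, of_apply, hb, sing]
    exact mul_comm _ _
  rw [← hAW, Matrix.mul_assoc, mem_orthogonalGroup_iff_mul_transpose.mp hW, Matrix.mul_one]

/-- The ordered spectrum of `Xᵀ X` is unique, and so are nonnegative square roots. Singular values
are computed below through this criterion. -/
theorem sing_eq_of_gram {X : Matrix (Fin m) (Fin n) ℝ} {W : Matrix (Fin n) (Fin n) ℝ}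
    (hW : W ∈ Matrix.orthogonalGroup (Fin n) ℝ) {a : Fin n → ℝ} (ha : Antitone a)
    (ha0 : ∀ i, 0 ≤ a i) (h : Xᵀ * X = W * diagonal (fun i => a i ^ 2) * Wᵀ) : sing X = a := by
  obtain ⟨W', hW', h'⟩ := exists_gram_eq_sing_sq X
  have key := eq_of_conj_diagonal_eq hW' hW
    (fun i j hij => pow_le_pow_left₀ (sing_nonneg X j) (sing_antitone X hij) 2)
    (fun i => sq_nonneg _)
    (fun i j hij => pow_le_pow_left₀ (ha0 j) (ha hij) 2)
    (fun i => sq_nonneg _) (h'.symm.trans h)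
  ext i
  exact (pow_left_inj₀ (sing_nonneg X i) (ha0 i) two_ne_zero).mp (congrFun key i)

theorem gram_conj_rdiag (hmn : n ≤ m) {U : Matrix (Fin m) (Fin m) ℝ}
    (hU : U ∈ Matrix.orthogonalGroup (Fin m) ℝ) (V : Matrix (Fin n) (Fin n) ℝ) (a : Fin n → ℝ) :
    (U * rdiag m a * Vᵀ)ᵀ * (U * rdiag m a * Vᵀ) = V * diagonal (fun i => a i ^ 2) * Vᵀ := by
  calc (U * rdiag m a * Vᵀ)ᵀ * (U * rdiag m a * Vᵀ)
      = V * ((rdiag m a)ᵀ * (Uᵀ * U) * rdiag m a) * Vᵀ := by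
        simp only [transpose_mul, transpose_transpose, Matrix.mul_assoc]
    _ = _ := by
        rw [mem_orthogonalGroup_iff_transpose_mul.mp hU, Matrix.mul_one,
          rdiag_transpose_mul_self hmn]

theorem sing_conj_rdiag (hmn : n ≤ m) {U : Matrix (Fin m) (Fin m) ℝ}
    {V : Matrix (Fin n) (Fin n) ℝ} (hU : U ∈ Matrix.orthogonalGroup (Fin m) ℝ)
    (hV : V ∈ Matrix.orthogonalGroup (Fin n) ℝ) {a : Fin n → ℝ} (ha : Antitone a)
    (ha0 : ∀ i, 0 ≤ a i) : sing (U * rdiag m a * Vᵀ) = a :=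
  sing_eq_of_gram hV ha ha0 (gram_conj_rdiag hmn hU V a)

/-- Existence of singular value decompositions. -/
theorem svdPairs_nonempty (hmn : n ≤ m) (X : Matrix (Fin m) (Fin n) ℝ) :
    (svdPairs X).Nonempty := by
  classical
  obtain ⟨W, hW, h⟩ := exists_gram_eq_sing_sq X
  set σ := sing X
  have hWW := mem_orthogonalGroup_iff_transpose_mul.mp hW
  have hG : (X * W)ᵀ * (X * W) = diagonal fun i => σ i ^ 2 := by
    calc (X * W)ᵀ * (X * W) = Wᵀ * (Xᵀ * X) * W := by
          simp only [transpose_mul, Matrix.mul_assoc]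
      _ = (Wᵀ * W) * diagonal (fun i => σ i ^ 2) * (Wᵀ * W) := by
          rw [h]; simp only [Matrix.mul_assoc]
      _ = _ := by rw [hWW, Matrix.one_mul, Matrix.mul_one]
  have hGij : ∀ i j, ∑ k, (X * W) k i * (X * W) k j = if i = j then σ i ^ 2 else 0 := by
    intro i j
    have := congrFun (congrFun hG i) j
    rw [mul_apply, diagonal_apply] at this
    simpa [transpose_apply] using this
  set v : Fin m → EuclideanSpace ℝ (Fin m) := fun i =>
    if hi : (i : ℕ) < n then WithLp.toLp 2 fun k => (X * W) k ⟨i, hi⟩ / σ ⟨i, hi⟩ else 0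
  set s : Set (Fin m) := {i | ∃ hi : (i : ℕ) < n, σ ⟨i, hi⟩ ≠ 0}
  have hv : Orthonormal ℝ (s.domRestrict v) := by
    rw [orthonormal_iff_ite]
    rintro ⟨i, hi, hσi⟩ ⟨j, hj, hσj⟩
    have := hGij ⟨i, hi⟩ ⟨j, hj⟩
    rw [Set.domRestrict_apply, Set.domRestrict_apply, PiLp.inner_apply]
    simp only [v, hi, hj, dif_pos]
    have e : ∑ k, inner ℝ ((X * W) k ⟨i, hi⟩ / σ ⟨i, hi⟩) ((X * W) k ⟨j, hj⟩ / σ ⟨j, hj⟩) =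
        (∑ k, (X * W) k ⟨i, hi⟩ * (X * W) k ⟨j, hj⟩) / (σ ⟨i, hi⟩ * σ ⟨j, hj⟩) := by
      rw [Finset.sum_div]
      refine Finset.sum_congr rfl fun k _ => ?_
      rw [← div_mul_div_comm]
      simp [mul_comm]
    rw [e, this]
    by_cases hij : i = j
    · subst hij
      simp only [if_true]
      field_simp
    · have : (⟨i, hi⟩ : Fin n) ≠ ⟨j, hj⟩ := fun h => hij (Fin.ext (Fin.mk.inj h))
      simp [this, hij]
  obtain ⟨b, hb⟩ := hv.exists_orthonormalBasis_extension_of_card_eq (by simp)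
  have hU := orthonormalBasis_matrix_mem_orthogonalGroup b
  set U : Matrix (Fin m) (Fin m) ℝ := Matrix.of fun i j => b j i with hUdef
  refine ⟨(U, W), hU, hW, ?_⟩
  have hXW : X * W = U * Sig X := by
    ext i j
    rw [Sig, mul_rdiag_apply hmn]
    -- If `σ j = 0`, the `j`-th column of `X * W` has squared norm `σ j ^ 2 = 0`, so the choice of
    -- the `j`-th left vector is immaterial.
    by_cases hσ : σ j = 0
    · have := hGij j j
      simp only [if_true, hσ] at this
      have h0 := (Finset.sum_eq_zero_iff_of_nonneg (fun k _ => mul_self_nonneg _)).mp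
        (this.trans (by norm_num)) i (Finset.mem_univ i)
      change _ = _ * σ j
      rw [hσ, mul_zero]
      exact mul_self_eq_zero.mp h0
    · have hmem : Fin.castLE hmn j ∈ s := ⟨j.2, hσ⟩
      simp only [hUdef, of_apply, hb _ hmem]
      simp only [v, Fin.val_castLE, Fin.is_lt, dif_pos]
      change _ = _ / σ j * σ j
      rw [div_mul_cancel₀ _ hσ]
  simp only
  rw [← hXW, Matrix.mul_assoc, mem_orthogonalGroup_iff_mul_transpose.mp hW, Matrix.mul_one]

theorem exists_svd (hmn : n ≤ m) (X : Matrix (Fin m) (Fin n) ℝ) :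
    ∃ U ∈ Matrix.orthogonalGroup (Fin m) ℝ, ∃ V ∈ Matrix.orthogonalGroup (Fin n) ℝ,
      X = U * Sig X * Vᵀ := by
  obtain ⟨⟨U, V⟩, hU, hV, hX⟩ := svdPairs_nonempty hmn X
  exact ⟨U, hU, V, hV, hX⟩

/-- Von Neumann's trace inequality. -/
theorem matInner_le_sing (hmn : n ≤ m) (A B : Matrix (Fin m) (Fin n) ℝ) :
    matInner A B ≤ sing A ⬝ᵥ sing B := by
  obtain ⟨U, hU, V, hV, hA⟩ := exists_svd hmn A
  obtain ⟨U', hU', V', hV', hB⟩ := exists_svd hmn B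
  have := matInner_svd_le hmn hU hV hU' hV' (sing_antitone A) (sing_nonneg A) (sing_antitone B)
    (sing_nonneg B)
  change A = U * Sig A * Vᵀ at hA
  rwa [← Sig, ← Sig, ← hA, ← hB] at this

theorem matInner_self_eq_sing (hmn : n ≤ m) (A : Matrix (Fin m) (Fin n) ℝ) :
    matInner A A = sing A ⬝ᵥ sing A := by
  obtain ⟨U, hU, V, hV, hA⟩ := exists_svd hmn A
  have := matInner_conj_self hU hV (Sig A) (Sig A)
  rwa [← hA, Sig, matInner_rdiag_rdiag hmn] at this

theorem sing_conj (hmn : n ≤ m) {U : Matrix (Fin m) (Fin m) ℝ}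
    {V : Matrix (Fin n) (Fin n) ℝ} (hU : U ∈ Matrix.orthogonalGroup (Fin m) ℝ)
    (hV : V ∈ Matrix.orthogonalGroup (Fin n) ℝ) (A : Matrix (Fin m) (Fin n) ℝ) :
    sing (U * A * Vᵀ) = sing A := by
  obtain ⟨U', hU', V', hV', hA⟩ := exists_svd hmn A
  have := sing_conj_rdiag hmn (mul_mem hU hU') (mul_mem hV hV') (sing_antitone A) (sing_nonneg A)
  rw [← this]
  congr 1
  conv_lhs => rw [hA]
  simp only [Sig, transpose_mul, Matrix.mul_assoc]

/-- Expanding both squares, the norms agree and the cross terms are compared by von Neumann's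
inequality. Thus `σ` is 1-Lipschitz, which later bounds its difference quotients. -/
theorem sing_sub_sq_le (hmn : n ≤ m) (A B : Matrix (Fin m) (Fin n) ℝ) :
    (sing A - sing B) ⬝ᵥ (sing A - sing B) ≤ matInner (A - B) (A - B) := by
  have := matInner_le_sing hmn A B
  rw [sub_dotProduct, dotProduct_sub, dotProduct_sub, dotProduct_comm (sing B) (sing A),
    matInner_sub_left, matInner_sub_right, matInner_sub_right, matInner_comm B A,
    matInner_self_eq_sing hmn A, matInner_self_eq_sing hmn B]
  linarith

/-- The equality case in von Neumann's trace inequality. -/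
theorem simulOrderedSVD_of_matInner_eq (hmn : n ≤ m) {A B : Matrix (Fin m) (Fin n) ℝ}
    (h : matInner A B = sing A ⬝ᵥ sing B) : SimulOrderedSVD A B := by
  -- Any decomposition of `A + B` will serve both matrices. With `c = a + b`, the pairings of `a`
  -- and `b` with `Uᵀ A V` and `Uᵀ B V` obey four trace inequalities whose sum is an equality. Each
  -- is therefore tight, which forces `Uᵀ A V` and `Uᵀ B V` to be the diagonal matrices of `a` and
  -- `b`.
  obtain ⟨U, hU, V, hV, hC⟩ := exists_svd hmn (A + B)
  set c := sing (A + B) with hc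
  set a := sing A with ha
  set b := sing B with hb
  have hUt := transpose_mem_orthogonalGroup hU
  have hVt := transpose_mem_orthogonalGroup hV
  have hinner : ∀ Z : Matrix (Fin m) (Fin n) ℝ, matInner (A + B) Z = matInner (rdiag m c) (Uᵀ * Z * V) := fun Z => by
    rw [hC, matInner_mul_mul, Sig]
  have hsing : ∀ Z : Matrix (Fin m) (Fin n) ℝ, sing (Uᵀ * Z * V) = sing Z := fun Z => by
    have := sing_conj hmn hUt hVt Z
    rwa [transpose_transpose] at this
  have hrd : ∀ d : Fin n → ℝ, Antitone d → (∀ i, 0 ≤ d i) → ∀ Z : Matrix (Fin m) (Fin n) ℝ,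
      matInner (rdiag m d) (Uᵀ * Z * V) ≤ d ⬝ᵥ sing Z := fun d hd hd0 Z => by
    have h1 := matInner_le_sing hmn (rdiag m d) (Uᵀ * Z * V)
    have h2 := sing_conj_rdiag (U := 1) (V := 1) hmn (one_mem _) (one_mem _) hd hd0
    rw [transpose_one, Matrix.one_mul, Matrix.mul_one] at h2
    rwa [h2, hsing] at h1
  have hcc : c ⬝ᵥ c = (a + b) ⬝ᵥ (a + b) := by
    rw [hc, ← matInner_self_eq_sing hmn, matInner_add_left, matInner_add_right,
      matInner_add_right, matInner_comm B A, h, matInner_self_eq_sing hmn A,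
      matInner_self_eq_sing hmn B, add_dotProduct, dotProduct_add, dotProduct_add,
      dotProduct_comm b a]
  have hcA : matInner (rdiag m c) (Uᵀ * A * V) ≤ c ⬝ᵥ a :=
    hrd c (sing_antitone _) (sing_nonneg _) A
  have hcB : matInner (rdiag m c) (Uᵀ * B * V) ≤ c ⬝ᵥ b :=
    hrd c (sing_antitone _) (sing_nonneg _) B
  have hsum : matInner (rdiag m c) (Uᵀ * A * V) + matInner (rdiag m c) (Uᵀ * B * V) =
      c ⬝ᵥ c := by
    rw [← hinner, ← hinner, ← matInner_add_right, matInner_self_eq_sing hmn]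
  -- The vectors `c` and `a + b` have equal norms and `c ⬝ᵥ c ≤ c ⬝ᵥ (a + b)`, so their distance is
  -- zero.
  have hcab : c = a + b := by
    have h0 : (c - (a + b)) ⬝ᵥ (c - (a + b)) ≤ 0 := by
      rw [sub_dotProduct, dotProduct_sub, dotProduct_sub, dotProduct_comm (a + b) c, ← hcc,
        dotProduct_add]
      linarith
    exact sub_eq_zero.mp (dotProduct_self_eq_zero.mp
      (le_antisymm h0 (Finset.sum_nonneg fun i _ => mul_self_nonneg _)))
  have hsplit : ∀ Z : Matrix (Fin m) (Fin n) ℝ, matInner (rdiag m c) Z =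
      matInner (rdiag m a) Z + matInner (rdiag m b) Z := fun Z => by
    rw [← matInner_add_left, hcab]
    congr 1
    ext i j
    by_cases hij : (i : ℕ) = j <;> simp [rdiag, hij]
  have hca : c ⬝ᵥ a = a ⬝ᵥ a + b ⬝ᵥ a := by rw [hcab, add_dotProduct]
  have hcb : c ⬝ᵥ b = a ⬝ᵥ b + b ⬝ᵥ b := by rw [hcab, add_dotProduct]
  have hcc' : c ⬝ᵥ c = c ⬝ᵥ a + c ⬝ᵥ b := by
    rw [← dotProduct_add, ← hcab]
  have haA := hrd a (sing_antitone _) (sing_nonneg _) A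
  have hbA := hrd b (sing_antitone _) (sing_nonneg _) A
  have haB := hrd a (sing_antitone _) (sing_nonneg _) B
  have hbB := hrd b (sing_antitone _) (sing_nonneg _) B
  rw [hsplit] at hcA hcB hsum
  rw [hsplit] at hsum
  have conclude : ∀ Z : Matrix (Fin m) (Fin n) ℝ,
      sing Z ⬝ᵥ sing Z ≤ matInner (rdiag m (sing Z)) (Uᵀ * Z * V) → Z = U * Sig Z * Vᵀ := by
    intro Z hZ
    have e : Uᵀ * Z * V = rdiag m (sing Z) := by
      refine eq_of_matInner_sub_self ?_
      rw [matInner_sub_left, matInner_sub_right, matInner_sub_right, matInner_rdiag_rdiag hmn,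
        matInner_self_eq_sing hmn, hsing, matInner_comm (Uᵀ * Z * V)]
      linarith
    rw [Sig, ← e]
    calc Z = (U * Uᵀ) * Z * (V * Vᵀ) := by
          rw [mem_orthogonalGroup_iff_mul_transpose.mp hU,
            mem_orthogonalGroup_iff_mul_transpose.mp hV, Matrix.one_mul, Matrix.mul_one]
      _ = _ := by simp only [Matrix.mul_assoc]
  exact ⟨(U, V), ⟨hU, hV, conclude A (by linarith)⟩, ⟨hU, hV, conclude B (by linarith)⟩⟩

theorem matInner_eq_of_simulOrderedSVD (hmn : n ≤ m) {A B : Matrix (Fin m) (Fin n) ℝ}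
    (h : SimulOrderedSVD A B) : matInner A B = sing A ⬝ᵥ sing B := by
  obtain ⟨⟨U, V⟩, ⟨hU, hV, hA⟩, ⟨-, -, hB⟩⟩ := h
  change A = U * Sig A * Vᵀ at hA
  change B = U * Sig B * Vᵀ at hB
  have := matInner_conj_self hU hV (Sig A) (Sig B)
  rwa [← hA, ← hB, Sig, Sig, matInner_rdiag_rdiag hmn] at this

end Sing

/-! ### Fan's trace inequality -/

section Fan

variable {k : ℕ}

theorem trace_conj_diagonal {W : Matrix (Fin k) (Fin k) ℝ}
    (hW : W ∈ Matrix.orthogonalGroup (Fin k) ℝ) (a : Fin k → ℝ) :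
    (W * diagonal a * Wᵀ).trace = ∑ i, a i := by
  rw [Matrix.trace_mul_comm, ← Matrix.mul_assoc, mem_orthogonalGroup_iff_transpose_mul.mp hW,
    Matrix.one_mul, trace_diagonal]

theorem conj_diagonal_add_smul_one {W : Matrix (Fin k) (Fin k) ℝ}
    (hW : W ∈ Matrix.orthogonalGroup (Fin k) ℝ) (a : Fin k → ℝ) (c : ℝ) :
    W * diagonal (fun i => a i + c) * Wᵀ = W * diagonal a * Wᵀ + c • 1 := by
  have : diagonal (fun i => a i + c) = diagonal a + c • (1 : Matrix (Fin k) (Fin k) ℝ) := by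
    rw [smul_one_eq_diagonal, diagonal_add]
  rw [this, Matrix.mul_add, Matrix.add_mul, Matrix.mul_smul, Matrix.mul_one, Matrix.smul_mul,
    mem_orthogonalGroup_iff_mul_transpose.mp hW]

theorem eigs_conj_diagonal {W : Matrix (Fin k) (Fin k) ℝ}
    (hW : W ∈ Matrix.orthogonalGroup (Fin k) ℝ) {a : Fin k → ℝ} (ha : Antitone a) :
    eigs (W * diagonal a * Wᵀ) = a := by
  set A := W * diagonal a * Wᵀ with hA
  have hsym : Aᵀ = A := by
    simp only [hA, transpose_mul, transpose_transpose, diagonal_transpose, Matrix.mul_assoc]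
  obtain ⟨W', hW', h⟩ := exists_orthogonal_diagonal_eigs hsym
  -- A shift large enough to make both spectra nonnegative, so that uniqueness for nonnegative
  -- spectra applies.
  set c := ∑ i, |a i| + ∑ i, |eigs A i|
  have hle : ∀ (b : Fin k → ℝ) (i : Fin k), -b i ≤ ∑ i, |b i| := fun b i =>
    (neg_le_abs _).trans
      (Finset.single_le_sum (f := fun i => |b i|) (fun _ _ => abs_nonneg _) (Finset.mem_univ i))
  have hnn : ∀ b : Fin k → ℝ, 0 ≤ ∑ i, |b i| := fun b =>
    Finset.sum_nonneg fun _ _ => abs_nonneg _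
  have key := eq_of_conj_diagonal_eq (a := fun i => eigs A i + c) (b := fun i => a i + c) hW' hW
    (fun i j hij => by simpa using eigs_antitone A hij)
    (fun i => by have := hle (eigs A) i; have := hnn a; simp only [c]; linarith)
    (fun i j hij => by simpa using ha hij)
    (fun i => by have := hle a i; have := hnn (eigs A); simp only [c]; linarith)
    (by rw [conj_diagonal_add_smul_one hW', conj_diagonal_add_smul_one hW, ← h])
  ext i
  simpa using congrFun key i

theorem sum_eigs {A : Matrix (Fin k) (Fin k) ℝ} (hA : Aᵀ = A) : ∑ i, eigs A i = A.trace := by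
  obtain ⟨W, hW, h⟩ := exists_orthogonal_diagonal_eigs hA
  conv_rhs => rw [h, trace_conj_diagonal hW]

/-- A large multiple of the identity turns eigenvalues into singular values, so Fan's inequality
follows from von Neumann's. The correction terms on the two sides agree because the trace is the sum
of the eigenvalues. -/
theorem sing_add_smul_one {A : Matrix (Fin k) (Fin k) ℝ} (hA : Aᵀ = A) {c : ℝ}
    (hc : ∀ i, 0 ≤ eigs A i + c) : sing (A + c • 1) = fun i => eigs A i + c := by
  obtain ⟨W, hW, h⟩ := exists_orthogonal_diagonal_eigs hA
  have := sing_conj_rdiag (a := fun i => eigs A i + c) le_rfl hW hW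
    (fun i j hij => by simpa using eigs_antitone A hij) hc
  rwa [rdiag_square, conj_diagonal_add_smul_one hW, ← h] at this

theorem exists_eigs_add_pos (A B : Matrix (Fin k) (Fin k) ℝ) :
    ∃ c : ℝ, (∀ i, 0 < eigs A i + c) ∧ ∀ i, 0 < eigs B i + c := by
  have hle : ∀ (b : Fin k → ℝ) (i : Fin k), -b i ≤ ∑ i, |b i| := fun b i =>
    (neg_le_abs _).trans
      (Finset.single_le_sum (f := fun i => |b i|) (fun _ _ => abs_nonneg _) (Finset.mem_univ i))
  have hnn : ∀ b : Fin k → ℝ, 0 ≤ ∑ i, |b i| := fun b =>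
    Finset.sum_nonneg fun _ _ => abs_nonneg _
  refine ⟨1 + ∑ i, |eigs A i| + ∑ i, |eigs B i|, fun i => ?_, fun i => ?_⟩
  · have := hle (eigs A) i; have := hnn (eigs B); linarith
  · have := hle (eigs B) i; have := hnn (eigs A); linarith

theorem matInner_add_smul_one (A B : Matrix (Fin k) (Fin k) ℝ) (c : ℝ) :
    matInner (A + c • 1) (B + c • 1) = matInner A B + c * A.trace + c * B.trace + c * c * k := by
  simp only [matInner, transpose_add, transpose_smul, transpose_one, Matrix.add_mul,
    Matrix.mul_add, Matrix.smul_mul, Matrix.mul_smul, Matrix.one_mul, Matrix.mul_one, trace_add,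
    trace_smul, trace_transpose, trace_one, Fintype.card_fin, smul_eq_mul]
  ring

theorem dotProduct_add_const (a b : Fin k → ℝ) (c : ℝ) :
    (fun i => a i + c) ⬝ᵥ (fun i => b i + c) =
      a ⬝ᵥ b + c * ∑ i, a i + c * ∑ i, b i + c * c * k := by
  have : ∀ i, (a i + c) * (b i + c) = a i * b i + c * a i + c * b i + c * c := fun i => by ring
  simp only [dotProduct, this, Finset.sum_add_distrib, Finset.mul_sum, Finset.sum_const,
    Finset.card_univ, Fintype.card_fin, nsmul_eq_mul]
  ring

/-- Fan's trace inequality. -/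
theorem matInner_le_eigs {A B : Matrix (Fin k) (Fin k) ℝ} (hA : Aᵀ = A) (hB : Bᵀ = B) :
    matInner A B ≤ eigs A ⬝ᵥ eigs B := by
  obtain ⟨c, hcA, hcB⟩ := exists_eigs_add_pos A B
  have := matInner_le_sing le_rfl (A + c • 1) (B + c • 1)
  rw [sing_add_smul_one hA fun i => (hcA i).le, sing_add_smul_one hB fun i => (hcB i).le,
    matInner_add_smul_one, dotProduct_add_const, sum_eigs hA, sum_eigs hB] at this
  linarith

/-- In the eigenbasis the hypothesis is `∑ a i * Q i i = ∑ a i` with `Q` orthogonal. Since `Q i i ≤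
1` and the weights are strictly positive, every `Q i i` is 1, whence `‖Q - 1‖² = k - 2k + k = 0`. -/
theorem eq_one_of_matInner_eq_trace {W O : Matrix (Fin k) (Fin k) ℝ}
    (hW : W ∈ Matrix.orthogonalGroup (Fin k) ℝ) (hO : O ∈ Matrix.orthogonalGroup (Fin k) ℝ)
    {a : Fin k → ℝ} (ha : ∀ i, 0 < a i)
    (h : matInner (W * diagonal a * Wᵀ) O = ∑ i, a i) : O = 1 := by
  set Q := Wᵀ * O * W with hQdef
  have hQ : Q ∈ Matrix.orthogonalGroup (Fin k) ℝ :=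
    mul_mem (mul_mem (transpose_mem_orthogonalGroup hW) hO) hW
  rw [matInner_mul_mul, ← rdiag_square, matInner_rdiag_left le_rfl] at h
  have hcast : ∀ i : Fin k, Fin.castLE le_rfl i = i := fun i => rfl
  simp only [hcast] at h
  have hle : ∀ i, Q i i ≤ 1 := fun i => by
    have h1 : Q i i ^ 2 ≤ ∑ j, Q i j ^ 2 :=
      Finset.single_le_sum (f := fun j => Q i j ^ 2) (fun _ _ => sq_nonneg _) (Finset.mem_univ i)
    rw [sum_row_sq_of_orthogonal hQ] at h1
    nlinarith
  have hdiag : ∀ i, Q i i = 1 := fun i => by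
    have h0 : ∑ i, a i * (1 - Q i i) = 0 := by
      simp only [mul_sub, mul_one, Finset.sum_sub_distrib]
      rw [sub_eq_zero]
      exact h.symm
    have := (Finset.sum_eq_zero_iff_of_nonneg fun i _ =>
      mul_nonneg (ha i).le (sub_nonneg.mpr (hle i))).mp h0 i (Finset.mem_univ i)
    rcases mul_eq_zero.mp this with h' | h'
    · exact absurd h' (ha i).ne'
    · linarith
  have hQ1 : Q = 1 := by
    refine eq_of_matInner_sub_self (le_of_eq ?_)
    have e1 : matInner Q Q = k := by
      rw [matInner, mem_orthogonalGroup_iff_transpose_mul.mp hQ, trace_one, Fintype.card_fin]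
    have e2 : matInner Q 1 = k := by
      simp [matInner, trace, hdiag]
    have e3 : matInner (1 : Matrix (Fin k) (Fin k) ℝ) 1 = k := by
      simp [matInner]
    rw [matInner_sub_left, matInner_sub_right, matInner_sub_right, e1, e2, matInner_comm, e2, e3]
    ring
  have hWW := mem_orthogonalGroup_iff_mul_transpose.mp hW
  calc O = (W * Wᵀ) * O * (W * Wᵀ) := by rw [hWW, Matrix.one_mul, Matrix.mul_one]
    _ = W * Q * Wᵀ := by simp only [hQdef, Matrix.mul_assoc]
    _ = 1 := by rw [hQ1, Matrix.mul_one, hWW]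

/-- The equality case in Fan's trace inequality. -/
theorem simulOrderedSpectral_of_matInner_eq {A B : Matrix (Fin k) (Fin k) ℝ} (hA : Aᵀ = A)
    (hB : Bᵀ = B) (h : matInner A B = eigs A ⬝ᵥ eigs B) : SimulOrderedSpectral A B := by
  obtain ⟨c, hcA, hcB⟩ := exists_eigs_add_pos A B
  have hsA := sing_add_smul_one hA fun i => (hcA i).le
  have hsB := sing_add_smul_one hB fun i => (hcB i).le
  obtain ⟨⟨U, V⟩, ⟨hU, hV, hA'⟩, ⟨-, -, hB'⟩⟩ :
      SimulOrderedSVD (A + c • 1) (B + c • 1) := by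
    refine simulOrderedSVD_of_matInner_eq le_rfl ?_
    rw [hsA, hsB, matInner_add_smul_one, dotProduct_add_const, sum_eigs hA, sum_eigs hB, h]
  change A + c • 1 = U * Sig (A + c • 1) * Vᵀ at hA'
  change B + c • 1 = U * Sig (B + c • 1) * Vᵀ at hB'
  change U ∈ _ at hU
  change V ∈ _ at hV
  rw [Sig, hsA, rdiag_square] at hA'
  rw [Sig, hsB, rdiag_square] at hB'
  obtain ⟨W, hW, hWA⟩ := exists_orthogonal_diagonal_eigs hA
  -- A singular value decomposition of the positive definite matrix `A + c • 1` must have `U = V`: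
  -- its pairing with `U * Vᵀ` equals its trace.
  have hO : U * Vᵀ = 1 := by
    refine eq_one_of_matInner_eq_trace (a := fun i => eigs A i + c) hW
      (mul_mem hU (transpose_mem_orthogonalGroup hV)) hcA ?_
    have h1 := matInner_conj_self hU hV (diagonal fun i => eigs A i + c) 1
    rw [Matrix.mul_one] at h1
    rw [conj_diagonal_add_smul_one hW, ← hWA, hA', h1]
    simp [matInner]
  have hUV : V = U := by
    calc V = (U * Vᵀ) * V := by rw [hO, Matrix.one_mul]
      _ = U := by
        rw [Matrix.mul_assoc, mem_orthogonalGroup_iff_transpose_mul.mp hV, Matrix.mul_one]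
  subst hUV
  refine ⟨V, hV, ?_, ?_⟩
  · rw [conj_diagonal_add_smul_one hV] at hA'
    exact add_right_cancel hA'
  · rw [conj_diagonal_add_smul_one hV] at hB'
    exact add_right_cancel hB'

theorem matInner_eq_of_simulOrderedSpectral {A B : Matrix (Fin k) (Fin k) ℝ}
    (h : SimulOrderedSpectral A B) : matInner A B = eigs A ⬝ᵥ eigs B := by
  obtain ⟨U, hU, hA, hB⟩ := h
  have := matInner_conj_self hU hU (diagonal (eigs A)) (diagonal (eigs B))
  rwa [← hA, ← hB, ← rdiag_square, ← rdiag_square, matInner_rdiag_rdiag le_rfl] at this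

end Fan

/-! ### Enumerations and blocks -/

theorem enum_strictMono {p : ℕ} (I : Finset (Fin p)) : StrictMono (enum I) :=
  (I.orderEmbOfFin rfl).strictMono

theorem enum_injective {p : ℕ} (I : Finset (Fin p)) : Function.Injective (enum I) :=
  (enum_strictMono I).injective

theorem enum_mem {p : ℕ} (I : Finset (Fin p)) (a : Fin I.card) : enum I a ∈ I :=
  I.orderEmbOfFin_mem rfl a

theorem mem_range_enum {p : ℕ} {I : Finset (Fin p)} {i : Fin p} :
    i ∈ Set.range (enum I) ↔ i ∈ I := by
  rw [enum, Finset.range_orderEmbOfFin, Finset.mem_coe]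

theorem sum_enum {p : ℕ} (I : Finset (Fin p)) (g : Fin p → ℝ) :
    ∑ a, g (enum I a) = ∑ i ∈ I, g i := by
  have : I = Finset.univ.image (enum I) := by
    ext i
    rw [← mem_range_enum]
    simp
  conv_rhs => rw [this]
  rw [Finset.sum_image fun _ _ _ _ h => enum_injective I h]

theorem card_filter_le_val (p r : ℕ) :
    (Finset.univ.filter fun s : Fin p => r ≤ (s : ℕ)).card = p - r := by
  have h1 := Finset.card_filter_add_card_filter_not (s := Finset.univ)
    (fun s : Fin p => (s : ℕ) < r)
  rw [Fin.card_filter_val_lt, Finset.card_univ, Fintype.card_fin] at h1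
  simp only [not_lt] at h1
  omega

theorem enum_filter_le_val {p : ℕ} (r : ℕ)
    (a : Fin (Finset.univ.filter fun s : Fin p => r ≤ (s : ℕ)).card) :
    (enum (Finset.univ.filter fun s : Fin p => r ≤ (s : ℕ)) a : ℕ) = r + a := by
  have hc := card_filter_le_val p r
  have := Finset.orderEmbOfFin_unique (s := Finset.univ.filter fun s : Fin p => r ≤ (s : ℕ)) rfl
    (f := fun a => (⟨r + a, by have := a.2; omega⟩ : Fin p)) (by simp) (fun a b hab => by
      simpa using hab)
  rw [enum, ← this]

theorem submatrix_mul_of_support {a b c : Type*} [Fintype b] {p q k : ℕ} (A : Matrix a b ℝ)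
    (B : Matrix b c ℝ) (r : Fin p → a) (s : Fin q → c) {f : Fin k → b}
    (hf : Function.Injective f)
    (h : ∀ i j, ∀ l ∉ Set.range f, A (r i) l * B l (s j) = 0) :
    (A * B).submatrix r s = A.submatrix r f * B.submatrix f s := by
  ext i j
  rw [submatrix_apply, mul_apply, mul_apply]
  exact (Fintype.sum_of_injective f hf _ _ (fun l hl => h i j l hl) fun _ => rfl).symm


theorem submatrix_mem_orthogonalGroup {p k : ℕ} {P : Matrix (Fin p) (Fin p) ℝ}
    (hP : P ∈ Matrix.orthogonalGroup (Fin p) ℝ) {f : Fin k → Fin p}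
    (hf : Function.Injective f) (h : ∀ i, ∀ l ∉ Set.range f, P (f i) l = 0) :
    P.submatrix f f ∈ Matrix.orthogonalGroup (Fin k) ℝ := by
  rw [mem_orthogonalGroup_iff_mul_transpose, transpose_submatrix,
    ← submatrix_mul_of_support P Pᵀ f f hf fun i j l hl => by rw [h i l hl, zero_mul],
    mem_orthogonalGroup_iff_mul_transpose.mp hP, submatrix_one f hf]

/-! ### The blocks of `Uᵀ H V` cut out by equal singular values of `X`. -/

section Blocks

variable {m n : ℕ}

/-- The singular values, extended by zero to all row indices. -/
noncomputable def rowSing (X : Matrix (Fin m) (Fin n) ℝ) (k : Fin m) : ℝ :=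
  if h : (k : ℕ) < n then sing X ⟨k, h⟩ else 0

theorem rowSing_castLE (hmn : n ≤ m) (X : Matrix (Fin m) (Fin n) ℝ) (i : Fin n) :
    rowSing X (Fin.castLE hmn i) = sing X i := by
  simp [rowSing]

theorem rank_le_cols (X : Matrix (Fin m) (Fin n) ℝ) : X.rank ≤ n := by
  simpa using X.rank_le_width

theorem rowSing_eq_zero_iff (X : Matrix (Fin m) (Fin n) ℝ) (k : Fin m) :
    rowSing X k = 0 ↔ X.rank ≤ k := by
  have := rank_le_cols X
  by_cases h : (k : ℕ) < n
  · simp [rowSing, h, sing_eq_zero_iff]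
  · simp only [rowSing, h, dif_neg, not_false_eq_true, true_iff]
    omega

theorem Sig_mul_apply (hmn : n ≤ m) (X : Matrix (Fin m) (Fin n) ℝ) {p : ℕ}
    (B : Matrix (Fin n) (Fin p) ℝ) (k : Fin m) (j : Fin p) :
    (Sig X * B) k j = if h : (k : ℕ) < n then sing X ⟨k, h⟩ * B ⟨k, h⟩ j else 0 := by
  by_cases h : (k : ℕ) < n
  · have := rdiag_mul_apply_castLE hmn B (sing X) ⟨k, h⟩ j
    rw [dif_pos h]
    exact this
  · simp only [h, dif_neg, not_false_eq_true, mul_apply]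
    refine Finset.sum_eq_zero fun l _ => ?_
    have : (k : ℕ) ≠ l := fun h' => h (h' ▸ l.2)
    simp [Sig, rdiag, this]

theorem mul_Sig_transpose_apply (hmn : n ≤ m) (X : Matrix (Fin m) (Fin n) ℝ) {p : ℕ}
    (B : Matrix (Fin p) (Fin n) ℝ) (i : Fin p) (k : Fin m) :
    (B * (Sig X)ᵀ) i k = if h : (k : ℕ) < n then B i ⟨k, h⟩ * sing X ⟨k, h⟩ else 0 := by
  have := Sig_mul_apply hmn X Bᵀ k i
  rw [← transpose_transpose (B * (Sig X)ᵀ), transpose_mul, transpose_transpose, transpose_apply,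
    this]
  simp only [transpose_apply, mul_comm]

/-- Orthogonal matrices intertwining `Σ(X)` with itself are block diagonal. -/
theorem intertwining_blocks (hmn : n ≤ m) {X : Matrix (Fin m) (Fin n) ℝ}
    {Q : Matrix (Fin m) (Fin m) ℝ} {P : Matrix (Fin n) (Fin n) ℝ}
    (h1 : Q * Sig X = Sig X * P) (h2 : (Sig X)ᵀ * Q = P * (Sig X)ᵀ) :
    (∀ i j, P i j ≠ 0 → sing X i = sing X j) ∧
    (∀ k l, Q k l ≠ 0 → rowSing X k = rowSing X l) ∧
    (∀ i j, sing X i ≠ 0 → Q (Fin.castLE hmn i) (Fin.castLE hmn j) = P i j) := by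
  set σ := sing X with hσ
  have hσ0 := sing_nonneg X
  have e1 : ∀ (k : Fin m) (j : Fin n), Q k (Fin.castLE hmn j) * σ j =
      if h : (k : ℕ) < n then σ ⟨k, h⟩ * P ⟨k, h⟩ j else 0 := fun k j => by
    rw [← Sig_mul_apply hmn, ← h1, Sig, mul_rdiag_apply hmn]
  have e2 : ∀ (i : Fin n) (k : Fin m), σ i * Q (Fin.castLE hmn i) k =
      if h : (k : ℕ) < n then P i ⟨k, h⟩ * σ ⟨k, h⟩ else 0 := fun i k => by
    rw [← mul_Sig_transpose_apply hmn, ← h2, ← transpose_apply Q, ← transpose_apply ((Sig X)ᵀ * Q),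
      transpose_mul, transpose_transpose, Sig, mul_rdiag_apply hmn, mul_comm]
  have e1' : ∀ i j : Fin n, Q (Fin.castLE hmn i) (Fin.castLE hmn j) * σ j = σ i * P i j :=
    fun i j => by simpa using e1 (Fin.castLE hmn i) j
  have e2' : ∀ i j : Fin n, σ i * Q (Fin.castLE hmn i) (Fin.castLE hmn j) = P i j * σ j :=
    fun i j => by simpa using e2 i (Fin.castLE hmn j)
  -- Eliminating `Q` from the two entrywise relations leaves `P` times a difference of squares;
  -- eliminating `P` does the same for `Q`.
  have hPsq : ∀ i j, P i j * (σ i ^ 2 - σ j ^ 2) = 0 := fun i j => by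
    have a1 := e1' i j; have a2 := e2' i j
    linear_combination (-σ i) * a1 + σ j * a2
  have hQsq : ∀ i j, Q (Fin.castLE hmn i) (Fin.castLE hmn j) * (σ i ^ 2 - σ j ^ 2) = 0 :=
    fun i j => by
    have a1 := e1' i j; have a2 := e2' i j
    linear_combination (-σ j) * a1 + σ i * a2
  have hsq : ∀ i j, σ i ^ 2 - σ j ^ 2 = 0 → σ i = σ j := fun i j h =>
    (pow_left_inj₀ (hσ0 i) (hσ0 j) two_ne_zero).mp (sub_eq_zero.mp h)
  have hPF : ∀ i j, P i j ≠ 0 → σ i = σ j := fun i j hne =>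
    hsq i j ((mul_eq_zero.mp (hPsq i j)).resolve_left hne)
  have hQF : ∀ i j, Q (Fin.castLE hmn i) (Fin.castLE hmn j) ≠ 0 → σ i = σ j := fun i j hne =>
    hsq i j ((mul_eq_zero.mp (hQsq i j)).resolve_left hne)
  refine ⟨hPF, fun k l hne => ?_, fun i j hi => ?_⟩
  -- Row indices beyond `n` belong to the singular value zero; there one side of the intertwining
  -- relation vanishes.
  · by_cases hk : (k : ℕ) < n <;> by_cases hl : (l : ℕ) < n
    · simp only [rowSing, hk, hl, dif_pos]
      exact hQF ⟨k, hk⟩ ⟨l, hl⟩ hne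
    · have := e2 ⟨k, hk⟩ l
      simp only [hl, dif_neg, not_false_eq_true] at this
      simp only [rowSing, hk, hl, dif_pos, dif_neg, not_false_eq_true]
      exact (mul_eq_zero.mp this).resolve_right hne
    · have := e1 k ⟨l, hl⟩
      simp only [hk, dif_neg, not_false_eq_true] at this
      simp only [rowSing, hk, hl, dif_pos, dif_neg, not_false_eq_true]
      exact ((mul_eq_zero.mp this).resolve_left hne).symm
    · simp [rowSing, hk, hl]
  · by_cases hij : σ i = σ j
    · have := e2' i j
      rw [← hij, mul_comm] at this
      exact mul_right_cancel₀ hi this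
    · rw [not_imp_comm.mp (hPF i j) hij, not_imp_comm.mp (hQF i j) hij]

/-- `d` is a first order expansion of `σ` at `X` along `H` in a suitable singular value
decomposition of `X`. -/
def IsSpectralDerivative (hmn : n ≤ m) (X H : Matrix (Fin m) (Fin n) ℝ) (d : Fin n → ℝ) : Prop :=
  ∃ U ∈ Matrix.orthogonalGroup (Fin m) ℝ, ∃ V ∈ Matrix.orthogonalGroup (Fin n) ℝ,
    X = U * Sig X * Vᵀ ∧
    (∀ i j, sing X i = sing X j → (Uᵀ * H * V) (Fin.castLE hmn i) j +
      (Uᵀ * H * V) (Fin.castLE hmn j) i = if i = j then 2 * d i else 0) ∧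
    (∀ (i : Fin m) (j : Fin n), X.rank ≤ i → X.rank ≤ j →
      (Uᵀ * H * V) i j = rdiag m d i j) ∧
    (∀ i j, i ≤ j → sing X i = sing X j → d j ≤ d i) ∧
    ∀ j, sing X j = 0 → 0 ≤ d j

theorem symBlock_apply (hmn : n ≤ m) (U : Matrix (Fin m) (Fin m) ℝ)
    (V : Matrix (Fin n) (Fin n) ℝ) (H : Matrix (Fin m) (Fin n) ℝ) (I : Finset (Fin n))
    (a b : Fin I.card) :
    symBlock hmn U V H I a b = 1 / 2 * ((Uᵀ * H * V) (Fin.castLE hmn (enum I a)) (enum I b) +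
      (Uᵀ * H * V) (Fin.castLE hmn (enum I b)) (enum I a)) := by
  have h : (Uᵀ * H * V) (Fin.castLE hmn (enum I b)) (enum I a) =
      (Vᵀ * Hᵀ * U) (enum I a) (Fin.castLE hmn (enum I b)) := by
    rw [← transpose_apply (Uᵀ * H * V)]
    simp only [transpose_mul, transpose_transpose, Matrix.mul_assoc]
  rw [h]
  rfl

theorem symBlock_transpose (hmn : n ≤ m) (U : Matrix (Fin m) (Fin m) ℝ)
    (V : Matrix (Fin n) (Fin n) ℝ) (H : Matrix (Fin m) (Fin n) ℝ) (I : Finset (Fin n)) :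
    (symBlock hmn U V H I)ᵀ = symBlock hmn U V H I := by
  ext a b
  rw [transpose_apply, symBlock_apply, symBlock_apply, add_comm]

theorem symBlock_eq (hmn : n ≤ m) (U : Matrix (Fin m) (Fin m) ℝ)
    (V : Matrix (Fin n) (Fin n) ℝ) (H : Matrix (Fin m) (Fin n) ℝ) (I : Finset (Fin n)) :
    symBlock hmn U V H I = (1 / 2 : ℝ) • ((Uᵀ * H * V).submatrix (rowEnum hmn I) (enum I) +
      ((Uᵀ * H * V).submatrix (rowEnum hmn I) (enum I))ᵀ) := by
  ext a b
  rw [symBlock_apply]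
  rfl

theorem mem_alphaIdx {X : Matrix (Fin m) (Fin n) ℝ} {c : ℝ} (hc : c ≠ 0) {i : Fin n} :
    i ∈ alphaIdx X c ↔ sing X i = c := by
  simp only [alphaIdx, Finset.mem_filter, Finset.mem_univ, true_and, and_iff_right_iff_imp]
  intro h
  by_contra h'
  exact hc (h ▸ (sing_eq_zero_iff X i).mpr (not_lt.mp h'))

theorem mem_betaIdx {X : Matrix (Fin m) (Fin n) ℝ} {i : Fin n} :
    i ∈ betaIdx X ↔ sing X i = 0 := by
  simp [betaIdx, sing_eq_zero_iff]

theorem mem_betaHatIdx {X : Matrix (Fin m) (Fin n) ℝ} {i : Fin m} :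
    i ∈ betaHatIdx X ↔ rowSing X i = 0 := by
  simp [betaHatIdx, rowSing_eq_zero_iff]

theorem rdiag_submatrix_beta (X : Matrix (Fin m) (Fin n) ℝ) (d : Fin n → ℝ) :
    (rdiag m d).submatrix (enum (betaHatIdx X)) (enum (betaIdx X)) =
      rdiag (betaHatIdx X).card (d ∘ enum (betaIdx X)) := by
  ext a b
  have h1 : (enum (betaHatIdx X) a : ℕ) = X.rank + a := enum_filter_le_val X.rank a
  have h2 : (enum (betaIdx X) b : ℕ) = X.rank + b := enum_filter_le_val X.rank b
  simp [rdiag, h1, h2]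

theorem card_betaIdx_le (hmn : n ≤ m) (X : Matrix (Fin m) (Fin n) ℝ) :
    (betaIdx X).card ≤ (betaHatIdx X).card := by
  rw [betaIdx, betaHatIdx, card_filter_le_val, card_filter_le_val]
  omega

variable {X H : Matrix (Fin m) (Fin n) ℝ} {d : Fin n → ℝ}

/-- The blocks of `Uᵀ H V` in an arbitrary singular value decomposition of `X`. -/
theorem IsSpectralDerivative.blocks (hmn : n ≤ m) (hd : IsSpectralDerivative hmn X H d)
    {U : Matrix (Fin m) (Fin m) ℝ} {V : Matrix (Fin n) (Fin n) ℝ}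
    (hU : U ∈ Matrix.orthogonalGroup (Fin m) ℝ) (hV : V ∈ Matrix.orthogonalGroup (Fin n) ℝ)
    (hX : X = U * Sig X * Vᵀ) :
    (∀ c, c ≠ 0 → eigs (symBlock hmn U V H (alphaIdx X c)) = d ∘ enum (alphaIdx X c)) ∧
    sing ((Uᵀ * H * V).submatrix (enum (betaHatIdx X)) (enum (betaIdx X))) =
      d ∘ enum (betaIdx X) := by
  obtain ⟨U', hU', V', hV', hX', hα, hβ, hmono, hnn⟩ := hd
  have hUU := mem_orthogonalGroup_iff_transpose_mul.mp hU
  have hVV := mem_orthogonalGroup_iff_transpose_mul.mp hV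
  have hUU' := mem_orthogonalGroup_iff_mul_transpose.mp hU'
  have hVV' := mem_orthogonalGroup_iff_mul_transpose.mp hV'
  have hUU'' := mem_orthogonalGroup_iff_transpose_mul.mp hU'
  have hVV'' := mem_orthogonalGroup_iff_transpose_mul.mp hV'
  -- Passing from one decomposition of `X` to another gives transition matrices that intertwine
  -- `Σ(X)` with itself, hence are block diagonal. So each block of `Uᵀ H V` depends only on the
  -- corresponding block of `U'ᵀ H V'`.
  set Q := Uᵀ * U' with hQdef
  set P := Vᵀ * V' with hPdef
  set S := Sig X with hS
  have hQ : Q ∈ Matrix.orthogonalGroup (Fin m) ℝ := mul_mem (transpose_mem_orthogonalGroup hU) hU'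
  have hP : P ∈ Matrix.orthogonalGroup (Fin n) ℝ := mul_mem (transpose_mem_orthogonalGroup hV) hV'
  have h1 : Q * S = S * P := by
    calc Q * S = Uᵀ * (U' * S * V'ᵀ) * V' := by
          simp only [hQdef, Matrix.mul_assoc, hVV'', Matrix.mul_one]
      _ = Uᵀ * (U * S * Vᵀ) * V' := by rw [← hX', ← hX]
      _ = (Uᵀ * U) * S * P := by simp only [hPdef, Matrix.mul_assoc]
      _ = S * P := by rw [hUU, Matrix.one_mul]
  have h2 : Sᵀ * Q = P * Sᵀ := by
    calc Sᵀ * Q = (Vᵀ * V) * Sᵀ * (Uᵀ * U') := by rw [hVV, Matrix.one_mul]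
      _ = Vᵀ * (U * S * Vᵀ)ᵀ * U' := by
          simp only [transpose_mul, transpose_transpose, Matrix.mul_assoc]
      _ = Vᵀ * (U' * S * V'ᵀ)ᵀ * U' := by rw [← hX', ← hX]
      _ = P * Sᵀ * (U'ᵀ * U') := by
          simp only [hPdef, transpose_mul, transpose_transpose, Matrix.mul_assoc]
      _ = P * Sᵀ := by rw [hUU'', Matrix.mul_one]
  obtain ⟨hPF, hQF, hQP⟩ := intertwining_blocks hmn h1 h2
  set M := U'ᵀ * H * V' with hM
  have hN : Uᵀ * H * V = Q * M * Pᵀ := by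
    calc Uᵀ * H * V = Uᵀ * (U' * U'ᵀ) * H * (V' * V'ᵀ) * V := by
          rw [hUU', hVV', Matrix.mul_one, Matrix.mul_one]
      _ = Q * M * Pᵀ := by
          simp only [hQdef, hPdef, hM, transpose_mul, transpose_transpose, Matrix.mul_assoc]
  constructor
  · intro c hc
    set I := alphaIdx X c with hI
    have hsI : ∀ a, sing X (enum I a) = c := fun a => (mem_alphaIdx hc).mp (enum_mem I a)
    have hPs : ∀ a, ∀ l ∉ Set.range (enum I), P (enum I a) l = 0 := fun a l hl => by
      by_contra hne
      exact hl (mem_range_enum.mpr ((mem_alphaIdx hc).mpr ((hPF _ _ hne).symm.trans (hsI a))))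
    have hQs : ∀ a, ∀ l ∉ Set.range (rowEnum hmn I), Q (rowEnum hmn I a) l = 0 :=
        fun a l hl => by
      by_contra hne
      have h3 := hQF _ _ hne
      rw [rowEnum, Function.comp_apply, rowSing_castLE, hsI] at h3
      have hln : (l : ℕ) < n := by
        by_contra hln
        exact hc (by simpa [rowSing, hln] using h3)
      rw [rowSing, dif_pos hln] at h3
      obtain ⟨b, hb⟩ := mem_range_enum.mpr ((mem_alphaIdx hc).mpr h3.symm)
      exact hl ⟨b, by rw [rowEnum, Function.comp_apply, hb]; rfl⟩
    have hinj : Function.Injective (rowEnum hmn I) :=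
      (Fin.castLE_injective hmn).comp (enum_injective I)
    set PI := P.submatrix (enum I) (enum I) with hPI
    have hPIO : PI ∈ Matrix.orthogonalGroup _ ℝ :=
      submatrix_mem_orthogonalGroup hP (enum_injective I) hPs
    -- For a nonzero singular value the row and column transitions coincide, so the block changes by
    -- an orthogonal similarity, which commutes with symmetrization and preserves the eigenvalues.
    have hQPI : Q.submatrix (rowEnum hmn I) (rowEnum hmn I) = PI := by
      ext a b
      exact hQP _ _ (by rw [hsI]; exact hc)
    have hNI : (Uᵀ * H * V).submatrix (rowEnum hmn I) (enum I) =
        PI * M.submatrix (rowEnum hmn I) (enum I) * PIᵀ := by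
      rw [hN, submatrix_mul_of_support (Q * M) Pᵀ _ _ (enum_injective I)
        (fun i j l hl => by rw [transpose_apply, hPs j l hl, mul_zero]),
        submatrix_mul_of_support Q M _ _ hinj (fun i j l hl => by rw [hQs i l hl, zero_mul]), hQPI]
      rfl
    have hsym : symBlock hmn U V H I = PI * diagonal (d ∘ enum I) * PIᵀ := by
      have hMI : (1 / 2 : ℝ) • (M.submatrix (rowEnum hmn I) (enum I) +
          (M.submatrix (rowEnum hmn I) (enum I))ᵀ) = diagonal (d ∘ enum I) := by
        ext a b
        have := hα (enum I a) (enum I b) ((hsI a).trans (hsI b).symm)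
        simp only [Matrix.smul_apply, Matrix.add_apply, submatrix_apply, transpose_apply, rowEnum,
          Function.comp_apply, this, diagonal_apply, (enum_injective I).eq_iff, smul_eq_mul]
        split_ifs <;> ring
      rw [symBlock_eq, hNI, ← hMI]
      simp only [transpose_mul, transpose_transpose, Matrix.mul_smul, Matrix.smul_mul,
        Matrix.mul_add, Matrix.add_mul, Matrix.mul_assoc]
    rw [hsym]
    exact eigs_conj_diagonal hPIO fun a b hab =>
      hmono _ _ ((enum_strictMono I).monotone hab) ((hsI a).trans (hsI b).symm)
  -- Here the row and column transitions are independent orthogonal matrices, so it is the singular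
  -- values of the block that are preserved.
  · set J := betaIdx X with hJ
    set K := betaHatIdx X with hK
    have hsJ : ∀ a, sing X (enum J a) = 0 := fun a => mem_betaIdx.mp (enum_mem J a)
    have hsK : ∀ a, rowSing X (enum K a) = 0 := fun a => mem_betaHatIdx.mp (enum_mem K a)
    have hPs : ∀ a, ∀ l ∉ Set.range (enum J), P (enum J a) l = 0 := fun a l hl => by
      by_contra hne
      exact hl (mem_range_enum.mpr (mem_betaIdx.mpr ((hPF _ _ hne).symm.trans (hsJ a))))
    have hQs : ∀ a, ∀ l ∉ Set.range (enum K), Q (enum K a) l = 0 := fun a l hl => by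
      by_contra hne
      exact hl (mem_range_enum.mpr (mem_betaHatIdx.mpr ((hQF _ _ hne).symm.trans (hsK a))))
    have hMI : M.submatrix (enum K) (enum J) = rdiag K.card (d ∘ enum J) := by
      rw [← rdiag_submatrix_beta]
      ext a b
      exact hβ _ _ ((rowSing_eq_zero_iff X _).mp (hsK a)) ((sing_eq_zero_iff X _).mp (hsJ b))
    rw [hN, submatrix_mul_of_support (Q * M) Pᵀ _ _ (enum_injective J)
        (fun i j l hl => by rw [transpose_apply, hPs j l hl, mul_zero]),
        submatrix_mul_of_support Q M _ _ (enum_injective K)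
          (fun i j l hl => by rw [hQs i l hl, zero_mul]), hMI, ← transpose_submatrix]
    exact sing_conj_rdiag (card_betaIdx_le hmn X)
      (submatrix_mem_orthogonalGroup hQ (enum_injective K) hQs)
      (submatrix_mem_orthogonalGroup hP (enum_injective J) hPs)
      (fun a b hab => hmono _ _ ((enum_strictMono J).monotone hab) ((hsJ a).trans (hsJ b).symm))
      (fun a => hnn _ (hsJ a))

/-- In one fixed decomposition of `X`, the block spectra determine every entry of `d`. Hence limits
along different ultrafilters agree. -/
theorem IsSpectralDerivative.unique (hmn : n ≤ m) {d' : Fin n → ℝ}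
    (hd : IsSpectralDerivative hmn X H d) (hd' : IsSpectralDerivative hmn X H d') : d = d' := by
  obtain ⟨U, hU, V, hV, hX⟩ := exists_svd hmn X
  obtain ⟨h1, h2⟩ := hd.blocks hmn hU hV hX
  obtain ⟨h1', h2'⟩ := hd'.blocks hmn hU hV hX
  ext i
  by_cases hi : sing X i = 0
  · obtain ⟨a, ha⟩ := mem_range_enum.mpr (mem_betaIdx.mpr hi)
    have := congrFun (h2.symm.trans h2') a
    simpa [ha] using this
  · obtain ⟨a, ha⟩ := mem_range_enum.mpr ((mem_alphaIdx hi).mpr rfl)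
    have := congrFun ((h1 _ hi).symm.trans (h1' _ hi)) a
    simpa [ha] using this

end Blocks

/-! ### Directional differentiability of the singular values -/

theorem tendsto_matrix_mul {α : Type*} {l : Filter α} {p q r : ℕ}
    {A : α → Matrix (Fin p) (Fin q) ℝ} {B : α → Matrix (Fin q) (Fin r) ℝ}
    {A₀ : Matrix (Fin p) (Fin q) ℝ} {B₀ : Matrix (Fin q) (Fin r) ℝ}
    (hA : Tendsto A l (𝓝 A₀)) (hB : Tendsto B l (𝓝 B₀)) :
    Tendsto (fun t => A t * B t) l (𝓝 (A₀ * B₀)) :=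
  ((continuous_fst.matrix_mul continuous_snd).tendsto (A₀, B₀)).comp (hA.prodMk_nhds hB)

theorem tendsto_matrix_transpose {α : Type*} {l : Filter α} {p q : ℕ}
    {A : α → Matrix (Fin p) (Fin q) ℝ} {A₀ : Matrix (Fin p) (Fin q) ℝ}
    (hA : Tendsto A l (𝓝 A₀)) : Tendsto (fun t => (A t)ᵀ) l (𝓝 A₀ᵀ) :=
  (continuous_id.matrix_transpose.tendsto A₀).comp hA

theorem tendsto_matrix_apply {α : Type*} {l : Filter α} {p q : ℕ}
    {A : α → Matrix (Fin p) (Fin q) ℝ} {A₀ : Matrix (Fin p) (Fin q) ℝ}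
    (hA : Tendsto A l (𝓝 A₀)) (i : Fin p) (j : Fin q) :
    Tendsto (fun t => A t i j) l (𝓝 (A₀ i j)) :=
  tendsto_pi_nhds.mp (tendsto_pi_nhds.mp hA i) j

theorem tendsto_matrix_of_apply {α : Type*} {l : Filter α} {p q : ℕ}
    {A : α → Matrix (Fin p) (Fin q) ℝ} {A₀ : Matrix (Fin p) (Fin q) ℝ}
    (h : ∀ i j, Tendsto (fun t => A t i j) l (𝓝 (A₀ i j))) : Tendsto A l (𝓝 A₀) :=
  tendsto_pi_nhds.mpr fun i => tendsto_pi_nhds.mpr fun j => h i j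

theorem tendsto_rdiag {α : Type*} {l : Filter α} (m : ℕ) {n : ℕ} {a : α → Fin n → ℝ}
    {a₀ : Fin n → ℝ} (h : Tendsto a l (𝓝 a₀)) :
    Tendsto (fun t => rdiag m (a t)) l (𝓝 (rdiag m a₀)) := by
  refine tendsto_matrix_of_apply fun i j => ?_
  by_cases hij : (i : ℕ) = j
  · simpa [rdiag, hij] using tendsto_pi_nhds.mp h j
  · simp [rdiag, hij, tendsto_const_nhds]

/-- Ultrafilters replace the extraction of subsequences: bounded quantities converge along them
simultaneously. -/
theorem exists_tendsto_ultrafilter_of_bounded {α : Type*} (𝒰 : Ultrafilter α) {h : α → ℝ} {C : ℝ}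
    (hC : ∀ᶠ t in (𝒰 : Filter α), |h t| ≤ C) : ∃ x, Tendsto h 𝒰 (𝓝 x) := by
  have hmem : Set.Icc (-C) C ∈ 𝒰.map h := by
    rw [Ultrafilter.mem_map, ← Ultrafilter.mem_coe]
    exact mem_of_superset hC fun t ht => abs_le.mp ht
  obtain ⟨x, -, hx⟩ := isCompact_Icc.ultrafilter_le_nhds (𝒰.map h) (le_principal_iff.mpr hmem)
  exact ⟨x, hx⟩

theorem abs_apply_le_one_of_orthogonal {k : ℕ} {U : Matrix (Fin k) (Fin k) ℝ}
    (hU : U ∈ Matrix.orthogonalGroup (Fin k) ℝ) (i j : Fin k) : |U i j| ≤ 1 := by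
  have h1 : U i j ^ 2 ≤ ∑ j, U i j ^ 2 :=
    Finset.single_le_sum (f := fun j => U i j ^ 2) (fun _ _ => sq_nonneg _) (Finset.mem_univ j)
  rw [sum_row_sq_of_orthogonal hU] at h1
  exact (sq_le_one_iff_abs_le_one _).mp h1

theorem exists_tendsto_orthogonal {α : Type*} (𝒰 : Ultrafilter α) {k : ℕ}
    {U : α → Matrix (Fin k) (Fin k) ℝ} (hU : ∀ t, U t ∈ Matrix.orthogonalGroup (Fin k) ℝ) :
    ∃ U₀ ∈ Matrix.orthogonalGroup (Fin k) ℝ, Tendsto U 𝒰 (𝓝 U₀) := by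
  choose U₀ hU₀ using fun i j => exists_tendsto_ultrafilter_of_bounded 𝒰
    (h := fun t => U t i j) (.of_forall fun t => abs_apply_le_one_of_orthogonal (hU t) i j)
  have hlim : Tendsto U 𝒰 (𝓝 (Matrix.of U₀)) := tendsto_matrix_of_apply hU₀
  refine ⟨Matrix.of U₀, ?_, hlim⟩
  rw [mem_orthogonalGroup_iff_mul_transpose]
  refine tendsto_nhds_unique (tendsto_matrix_mul hlim (tendsto_matrix_transpose hlim)) ?_
  simp only [fun t => mem_orthogonalGroup_iff_mul_transpose.mp (hU t)]
  exact tendsto_const_nhds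

section DirDeriv

variable {m n : ℕ}

theorem rdiag_add_smul (a b : Fin n → ℝ) (t : ℝ) :
    rdiag m (a + t • b) = rdiag m a + t • rdiag m b := by
  ext i j
  by_cases hij : (i : ℕ) = j <;> simp [rdiag, hij]

theorem rdiag_transpose_mul_apply (hmn : n ≤ m) {p : ℕ} (a : Fin n → ℝ)
    (B : Matrix (Fin m) (Fin p) ℝ) (i : Fin n) (j : Fin p) :
    ((rdiag m a)ᵀ * B) i j = a i * B (Fin.castLE hmn i) j := by
  rw [← transpose_transpose ((rdiag m a)ᵀ * B), transpose_mul, transpose_transpose,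
    transpose_apply, mul_rdiag_apply hmn, transpose_apply, mul_comm]

theorem mul_rdiag_transpose_apply_castLE (hmn : n ≤ m) {p : ℕ} (B : Matrix (Fin p) (Fin n) ℝ)
    (a : Fin n → ℝ) (i : Fin p) (j : Fin n) :
    (B * (rdiag m a)ᵀ) i (Fin.castLE hmn j) = B i j * a j := by
  rw [← transpose_transpose (B * (rdiag m a)ᵀ), transpose_mul, transpose_transpose,
    transpose_apply, rdiag_mul_apply_castLE hmn, transpose_apply, mul_comm]

theorem abs_sing_quotient_le (hmn : n ≤ m) (X H : Matrix (Fin m) (Fin n) ℝ) {t : ℝ} (ht : 0 < t)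
    (j : Fin n) : |(t⁻¹ • (sing (X + t • H) - sing X)) j| ≤ √(matInner H H) := by
  refine Real.abs_le_sqrt ?_
  have h1 := sing_sub_sq_le hmn (X + t • H) X
  rw [add_sub_cancel_left, matInner_smul_right, matInner_comm, matInner_smul_right] at h1
  have h2 : (sing (X + t • H) j - sing X j) ^ 2 ≤
      (sing (X + t • H) - sing X) ⬝ᵥ (sing (X + t • H) - sing X) := by
    rw [sq]
    exact Finset.single_le_sum
      (f := fun j => (sing (X + t • H) j - sing X j) * (sing (X + t • H) j - sing X j))
      (fun _ _ => mul_self_nonneg _) (Finset.mem_univ j)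
  rw [Pi.smul_apply, Pi.sub_apply, smul_eq_mul, mul_pow, inv_pow, inv_mul_le_iff₀ (by positivity)]
  nlinarith

/-- Decompositions of `X + tH` converge along the ultrafilter to a decomposition `(U₀, V₀)` of `X`.
Comparing the two gives relations in which, on blocks of equal singular values, the unknown
variations of `U t` and `V t` cancel; dividing by `t` and passing to the limit reads off the blocks.
-/
theorem exists_isSpectralDerivative_ultrafilter (hmn : n ≤ m) (X H : Matrix (Fin m) (Fin n) ℝ)
    (𝒰 : Ultrafilter ℝ) (h𝒰 : (𝒰 : Filter ℝ) ≤ 𝓝[>] (0 : ℝ)) :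
    ∃ d, Tendsto (fun t : ℝ => t⁻¹ • (sing (X + t • H) - sing X)) 𝒰 (𝓝 d) ∧
      IsSpectralDerivative hmn X H d := by
  have hpos : ∀ᶠ t in (𝒰 : Filter ℝ), 0 < t := h𝒰 self_mem_nhdsWithin
  have ht0 : Tendsto (fun t : ℝ => t) 𝒰 (𝓝 0) := h𝒰.trans nhdsWithin_le_nhds
  choose U hU V hV hX using fun t : ℝ => exists_svd hmn (X + t • H)
  set q := fun t : ℝ => t⁻¹ • (sing (X + t • H) - sing X) with hq
  obtain ⟨U₀, hU₀, hUlim⟩ := exists_tendsto_orthogonal 𝒰 hU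
  obtain ⟨V₀, hV₀, hVlim⟩ := exists_tendsto_orthogonal 𝒰 hV
  choose d hd using fun j => exists_tendsto_ultrafilter_of_bounded 𝒰 (h := fun t => q t j)
    (hpos.mono fun t ht => abs_sing_quotient_le hmn X H ht j)
  have hqlim : Tendsto q 𝒰 (𝓝 d) := tendsto_pi_nhds.mpr hd
  have hqt : ∀ t : ℝ, 0 < t → sing (X + t • H) = sing X + t • q t := fun t ht => by
    rw [hq, smul_smul, mul_inv_cancel₀ ht.ne', one_smul, add_sub_cancel]
  have hSig : ∀ t : ℝ, 0 < t → Sig (X + t • H) = Sig X + t • rdiag m (q t) := fun t ht => by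
    rw [Sig, hqt t ht, rdiag_add_smul, Sig]
  have hSlim : Tendsto (fun t : ℝ => Sig (X + t • H)) 𝒰 (𝓝 (Sig X)) := by
    have : Tendsto (fun t : ℝ => Sig X + t • rdiag m (q t)) 𝒰 (𝓝 (Sig X)) := by
      simpa using tendsto_const_nhds.add (ht0.smul (tendsto_rdiag m hqlim))
    exact this.congr' (hpos.mono fun t ht => (hSig t ht).symm)
  have hX₀ : X = U₀ * Sig X * V₀ᵀ := by
    refine tendsto_nhds_unique (f := fun t : ℝ => X + t • H) (l := (𝒰 : Filter ℝ)) ?_ ?_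
    · simpa using tendsto_const_nhds.add (ht0.smul (tendsto_const_nhds (x := H)))
    · refine (tendsto_matrix_mul (tendsto_matrix_mul hUlim hSlim)
        (tendsto_matrix_transpose hVlim)).congr fun t => (hX t).symm
  have hUU := mem_orthogonalGroup_iff_transpose_mul.mp hU₀
  have hVV := mem_orthogonalGroup_iff_transpose_mul.mp hV₀
  set Z := fun t => U₀ᵀ * U t with hZ
  set W := fun t => V₀ᵀ * V t with hW
  have hZlim : Tendsto Z 𝒰 (𝓝 1) := hUU ▸ tendsto_matrix_mul tendsto_const_nhds hUlim
  have hWlim : Tendsto W 𝒰 (𝓝 1) := hVV ▸ tendsto_matrix_mul tendsto_const_nhds hVlim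
  set M := fun t => U₀ᵀ * H * V t with hM
  set N := fun t => V₀ᵀ * Hᵀ * U t with hN
  have hMlim : Tendsto M 𝒰 (𝓝 (U₀ᵀ * H * V₀)) := tendsto_matrix_mul tendsto_const_nhds hVlim
  have hNlim : Tendsto N 𝒰 (𝓝 (U₀ᵀ * H * V₀)ᵀ) := by
    have := tendsto_matrix_mul (tendsto_const_nhds (x := V₀ᵀ * Hᵀ)) hUlim
    simpa only [transpose_mul, transpose_transpose, Matrix.mul_assoc, hN] using this
  -- The exact identity obtained by evaluating `U₀ᵀ (X + tH) V t` in both decompositions; `e2` is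
  -- its counterpart for the transpose.
  have e1 : ∀ t : ℝ, 0 < t →
      Sig X * W t + t • M t = Z t * Sig X + t • (Z t * rdiag m (q t)) := fun t ht => by
    calc Sig X * W t + t • M t
        = (U₀ᵀ * U₀) * Sig X * V₀ᵀ * V t + t • (U₀ᵀ * H * V t) := by
          rw [hUU, Matrix.one_mul, hW, Matrix.mul_assoc]
      _ = U₀ᵀ * (U₀ * Sig X * V₀ᵀ + t • H) * V t := by
          simp only [Matrix.mul_add, Matrix.add_mul, Matrix.mul_smul, Matrix.smul_mul,
            Matrix.mul_assoc]
      _ = U₀ᵀ * (U t * Sig (X + t • H) * (V t)ᵀ) * V t := by rw [← hX₀, ← hX t]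
      _ = Z t * Sig (X + t • H) * ((V t)ᵀ * V t) := by simp only [hZ, Matrix.mul_assoc]
      _ = _ := by
          rw [mem_orthogonalGroup_iff_transpose_mul.mp (hV t), Matrix.mul_one, hSig t ht,
            Matrix.mul_add, Matrix.mul_smul]
  have e2 : ∀ t : ℝ, 0 < t →
      (Sig X)ᵀ * Z t + t • N t = W t * (Sig X)ᵀ + t • (W t * (rdiag m (q t))ᵀ) := fun t ht => by
    calc (Sig X)ᵀ * Z t + t • N t
        = (V₀ᵀ * V₀) * (Sig X)ᵀ * U₀ᵀ * U t + t • (V₀ᵀ * Hᵀ * U t) := by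
          rw [hVV, Matrix.one_mul, hZ, Matrix.mul_assoc]
      _ = V₀ᵀ * (U₀ * Sig X * V₀ᵀ + t • H)ᵀ * U t := by
          simp only [Matrix.mul_add, Matrix.add_mul, Matrix.mul_smul, Matrix.smul_mul,
            Matrix.mul_assoc, transpose_add, transpose_smul, transpose_mul, transpose_transpose]
      _ = V₀ᵀ * (U t * Sig (X + t • H) * (V t)ᵀ)ᵀ * U t := by rw [← hX₀, ← hX t]
      _ = W t * (Sig (X + t • H))ᵀ * ((U t)ᵀ * U t) := by
          simp only [hW, transpose_mul, transpose_transpose, Matrix.mul_assoc]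
      _ = _ := by
          rw [mem_orthogonalGroup_iff_transpose_mul.mp (hU t), Matrix.mul_one, hSig t ht,
            transpose_add, transpose_smul, Matrix.mul_add, Matrix.mul_smul]
  refine ⟨d, hqlim, U₀, hU₀, V₀, hV₀, hX₀, fun i j hij => ?_, fun i j hi hj => ?_,
    fun i j hij hσ => ?_, fun j hj => ?_⟩
  · have l1 : Tendsto (fun t => M t (Fin.castLE hmn i) j + N t i (Fin.castLE hmn j)) 𝒰
        (𝓝 ((U₀ᵀ * H * V₀) (Fin.castLE hmn i) j + (U₀ᵀ * H * V₀) (Fin.castLE hmn j) i)) :=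
      (tendsto_matrix_apply hMlim _ _).add (tendsto_matrix_apply hNlim _ _)
    have l2 : Tendsto (fun t => (Z t (Fin.castLE hmn i) (Fin.castLE hmn j) + W t i j) * q t j) 𝒰
        (𝓝 (((1 : Matrix (Fin m) (Fin m) ℝ) (Fin.castLE hmn i) (Fin.castLE hmn j) +
          (1 : Matrix (Fin n) (Fin n) ℝ) i j) * d j)) :=
      ((tendsto_matrix_apply hZlim _ _).add (tendsto_matrix_apply hWlim _ _)).mul (hd j)
    have heq : ∀ᶠ t in (𝒰 : Filter ℝ), M t (Fin.castLE hmn i) j + N t i (Fin.castLE hmn j) =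
        (Z t (Fin.castLE hmn i) (Fin.castLE hmn j) + W t i j) * q t j := by
      filter_upwards [hpos] with t ht
      have a1 := congrFun (congrFun (e1 t ht) (Fin.castLE hmn i)) j
      have a2 := congrFun (congrFun (e2 t ht) i) (Fin.castLE hmn j)
      simp only [Matrix.add_apply, Matrix.smul_apply, smul_eq_mul, Sig, mul_rdiag_apply hmn,
        rdiag_mul_apply_castLE hmn] at a1
      simp only [Matrix.add_apply, Matrix.smul_apply, smul_eq_mul, Sig,
        rdiag_transpose_mul_apply hmn, mul_rdiag_transpose_apply_castLE hmn] at a2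
      -- With equal singular values, adding the two identities cancels every term that lacks a
      -- factor `t`.
      rw [hij] at a1 a2
      refine mul_left_cancel₀ ht.ne' ?_
      linear_combination a1 + a2
    rw [tendsto_nhds_unique (l1.congr' heq) l2]
    by_cases h : i = j
    · subst h
      simp only [one_apply_eq, if_true]
      ring
    · simp [one_apply, h]
  · have l1 := tendsto_matrix_apply hMlim i j
    have l2 := tendsto_matrix_apply (tendsto_matrix_mul hZlim (tendsto_rdiag m hqlim)) i j
    rw [Matrix.one_mul] at l2
    refine tendsto_nhds_unique l1 (l2.congr' ?_)
    filter_upwards [hpos] with t ht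
    have a1 := congrFun (congrFun (e1 t ht) i) j
    -- On the `β̂ × β` block the terms without a factor `t` already vanish in `e1`, so no
    -- symmetrization is needed.
    have z1 : (Sig X * W t) i j = 0 := by
      rw [Sig_mul_apply hmn]
      split_ifs with h
      · rw [(sing_eq_zero_iff X ⟨i, h⟩).mpr hi, zero_mul]
      · rfl
    have z2 : (Z t * Sig X) i j = 0 := by
      rw [Sig, mul_rdiag_apply hmn, (sing_eq_zero_iff X j).mpr hj, mul_zero]
    simp only [Matrix.add_apply, Matrix.smul_apply, z1, z2, zero_add, smul_eq_mul] at a1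
    exact (mul_left_cancel₀ ht.ne' a1).symm
  · refine le_of_tendsto_of_tendsto (hd j) (hd i) ?_
    filter_upwards [hpos] with t ht
    simp only [hq, Pi.smul_apply, Pi.sub_apply, smul_eq_mul, hσ]
    exact mul_le_mul_of_nonneg_left
      (sub_le_sub_right (sing_antitone (X + t • H) hij) _) (inv_nonneg.mpr ht.le)
  · refine ge_of_tendsto (hd j) ?_
    filter_upwards [hpos] with t ht
    simp only [hq, Pi.smul_apply, Pi.sub_apply, smul_eq_mul, hj, sub_zero]
    exact mul_nonneg (inv_nonneg.mpr ht.le) (sing_nonneg _ _)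

/-- The singular values are directionally differentiable. -/
theorem exists_hasDirDeriv_sing (hmn : n ≤ m) (X H : Matrix (Fin m) (Fin n) ℝ) :
    ∃ d, HasDirDeriv sing X H d ∧ IsSpectralDerivative hmn X H d := by
  obtain ⟨d, -, hd⟩ := exists_isSpectralDerivative_ultrafilter hmn X H
    (Ultrafilter.of (𝓝[>] (0 : ℝ))) (Ultrafilter.of_le _)
  refine ⟨d, ?_, hd⟩
  -- Convergence may be tested on ultrafilters, and each limit is a spectral derivative, hence equal
  -- to `d` by uniqueness.
  rw [HasDirDeriv, tendsto_iff_ultrafilter]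
  intro 𝒰 h𝒰
  obtain ⟨d', hlim, hd'⟩ := exists_isSpectralDerivative_ultrafilter hmn X H 𝒰 h𝒰
  rwa [hd.unique hmn hd']

end DirDeriv

/-! ### Absolutely symmetric functions of singular values -/

section Symmetric

variable {m n : ℕ}

/-- Sort by decreasing absolute value and flip signs. The final commutation identity transfers the
Gram matrix of `U * rdiag m x * Vᵀ` to the sorted vector. -/
theorem exists_isSignedPerm_sort (x : Fin n → ℝ) :
    ∃ Q : Matrix (Fin n) (Fin n) ℝ, IsSignedPerm Q ∧ Q ∈ Matrix.orthogonalGroup (Fin n) ℝ ∧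
      Antitone (Q *ᵥ x) ∧ (∀ i, 0 ≤ (Q *ᵥ x) i) ∧
      diagonal (fun i => (Q *ᵥ x) i ^ 2) * Q = Q * diagonal fun i => x i ^ 2 := by
  classical
  set τ := Tuple.sort fun i => -|x i| with hτ
  have hmono : Monotone ((fun i => -|x i|) ∘ τ) := Tuple.monotone_sort _
  set s : Fin n → ℝ := fun j => if 0 ≤ x j then 1 else -1 with hs
  have hs1 : ∀ j, s j = 1 ∨ s j = -1 := fun j => by
    simp only [hs]; split_ifs <;> simp
  have hs0 : ∀ j, s j ≠ 0 := fun j => by rcases hs1 j with h | h <;> simp [h]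
  have hss : ∀ j, s j * s j = 1 := fun j => by rcases hs1 j with h | h <;> simp [h]
  have hsx : ∀ j, s j * x j = |x j| := fun j => by
    simp only [hs]
    split_ifs with h
    · rw [one_mul, abs_of_nonneg h]
    · rw [abs_of_neg (not_le.mp h), neg_one_mul]
  set Q : Matrix (Fin n) (Fin n) ℝ := Matrix.of fun i j => if j = τ i then s j else 0 with hQ
  have hQx : ∀ i, (Q *ᵥ x) i = |x (τ i)| := fun i => by
    simp [hQ, mulVec, dotProduct, hsx]
  refine ⟨Q, ⟨fun i j => ?_, fun i => ?_, fun j => ?_⟩, ?_, fun i j hij => ?_, fun i => ?_, ?_⟩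
  · simp only [hQ, of_apply]
    split_ifs
    · exact Or.inr (hs1 j)
    · exact Or.inl rfl
  · refine ⟨τ i, by simp [hQ, hs0], fun j hj => ?_⟩
    by_contra h
    exact hj (by simp [hQ, h])
  · refine ⟨τ.symm j, by simp [hQ, hs0], fun i hi => ?_⟩
    by_contra h
    refine hi ?_
    simp only [hQ, of_apply]
    rw [if_neg]
    rintro rfl
    simp at h
  · rw [mem_orthogonalGroup_iff_mul_transpose]
    ext i j
    by_cases h : i = j
    · subst h
      simp [hQ, mul_apply, hss]
    · simp [hQ, mul_apply, h, Ne.symm h]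
  · rw [hQx, hQx]
    simpa using hmono hij
  · rw [hQx]
    exact abs_nonneg _
  · ext i j
    rw [diagonal_mul, mul_diagonal, hQx, sq_abs]
    simp only [hQ, of_apply]
    split_ifs with h
    · rw [h, mul_comm]
    · simp

/-- The singular values of this matrix are the sorted absolute values of `x`, a signed permutation
that `f` does not see. Arbitrary test points of `ℝⁿ` thus lift to matrices. -/
theorem apply_sing_conj_rdiag (hmn : n ≤ m) {f : (Fin n → ℝ) → EReal}
    (hf : AbsolutelySymmetric f) {U : Matrix (Fin m) (Fin m) ℝ} {V : Matrix (Fin n) (Fin n) ℝ}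
    (hU : U ∈ Matrix.orthogonalGroup (Fin m) ℝ) (hV : V ∈ Matrix.orthogonalGroup (Fin n) ℝ)
    (x : Fin n → ℝ) : f (sing (U * rdiag m x * Vᵀ)) = f x := by
  obtain ⟨Q, hQ, hQO, hanti, hnn, hcomm⟩ := exists_isSignedPerm_sort x
  rw [← hf x Q hQ]
  congr 1
  refine sing_eq_of_gram (W := V * Qᵀ) (mul_mem hV (transpose_mem_orthogonalGroup hQO)) hanti hnn ?_
  rw [gram_conj_rdiag hmn hU]
  have h1 : diagonal (fun i => x i ^ 2) = Qᵀ * diagonal (fun i => (Q *ᵥ x) i ^ 2) * Q := by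
    rw [Matrix.mul_assoc, hcomm, ← Matrix.mul_assoc, mem_orthogonalGroup_iff_transpose_mul.mp hQO,
      Matrix.one_mul]
  rw [h1]
  simp only [transpose_mul, transpose_transpose, Matrix.mul_assoc]

/-! ### The chain rule for subderivatives -/

/-- The Lipschitz bound upgrades the derivative along a fixed `H` to one along varying directions,
as the subderivative requires. -/
theorem tendsto_sing_quotient (hmn : n ≤ m) {X H : Matrix (Fin m) (Fin n) ℝ} {d : Fin n → ℝ}
    (hd : HasDirDeriv sing X H d) :
    Tendsto (fun p : ℝ × Matrix (Fin m) (Fin n) ℝ => p.1⁻¹ • (sing (X + p.1 • p.2) - sing X))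
      (𝓝[>] (0 : ℝ) ×ˢ 𝓝 H) (𝓝 d) := by
  have h1 : Tendsto (fun p : ℝ × Matrix (Fin m) (Fin n) ℝ =>
      p.1⁻¹ • (sing (X + p.1 • H) - sing X)) (𝓝[>] (0 : ℝ) ×ˢ 𝓝 H) (𝓝 d) :=
    hd.comp tendsto_fst
  have h2 : Tendsto (fun p : ℝ × Matrix (Fin m) (Fin n) ℝ =>
      p.1⁻¹ • (sing (X + p.1 • p.2) - sing (X + p.1 • H))) (𝓝[>] (0 : ℝ) ×ˢ 𝓝 H) (𝓝 0) := by
    rw [tendsto_pi_nhds]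
    intro j
    have hb : Tendsto (fun p : ℝ × Matrix (Fin m) (Fin n) ℝ =>
        √(matInner (p.2 - H) (p.2 - H))) (𝓝[>] (0 : ℝ) ×ˢ 𝓝 H) (𝓝 0) := by
      have hc : Continuous fun K : Matrix (Fin m) (Fin n) ℝ => √(matInner (K - H) (K - H)) := by
        simp only [matInner_eq_sum]
        fun_prop
      have := (hc.tendsto H).comp (tendsto_snd (f := 𝓝[>] (0 : ℝ)))
      simpa [Function.comp_def, matInner] using this
    refine squeeze_zero_norm' ?_ hb
    filter_upwards [tendsto_fst.eventually (self_mem_nhdsWithin (a := (0 : ℝ)) (s := Set.Ioi 0))]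
      with p hp
    have := abs_sing_quotient_le hmn (X + p.1 • H) (p.2 - H) hp j
    rwa [add_assoc, ← smul_add, add_sub_cancel] at this
  have := h1.add h2
  simp only [← smul_add, add_zero] at this
  refine this.congr fun p => ?_
  congr 1
  abel

/-- Directions near `d` in `ℝⁿ` lift to matrix directions near `H` by way of decompositions of `X +
tH`. The error is a conjugate of `rdiag m (p.2 - q p.1)`, whose norm is that of a vector tending to
zero. -/
theorem tendsto_conj_rdiag_quotient (hmn : n ≤ m) {X H : Matrix (Fin m) (Fin n) ℝ}
    {d : Fin n → ℝ} (hd : HasDirDeriv sing X H d) {U : ℝ → Matrix (Fin m) (Fin m) ℝ}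
    {V : ℝ → Matrix (Fin n) (Fin n) ℝ} (hU : ∀ t, U t ∈ Matrix.orthogonalGroup (Fin m) ℝ)
    (hV : ∀ t, V t ∈ Matrix.orthogonalGroup (Fin n) ℝ)
    (hX : ∀ t : ℝ, X + t • H = U t * Sig (X + t • H) * (V t)ᵀ) :
    Tendsto (fun p : ℝ × (Fin n → ℝ) =>
      p.1⁻¹ • (U p.1 * rdiag m (sing X + p.1 • p.2) * (V p.1)ᵀ - X))
      (𝓝[>] (0 : ℝ) ×ˢ 𝓝 d) (𝓝 H) := by
  set q := fun t : ℝ => t⁻¹ • (sing (X + t • H) - sing X) with hq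
  have he : Tendsto (fun p : ℝ × (Fin n → ℝ) => p.2 - q p.1) (𝓝[>] (0 : ℝ) ×ˢ 𝓝 d) (𝓝 0) := by
    have := (tendsto_snd (f := 𝓝[>] (0 : ℝ)) (g := 𝓝 d)).sub
      ((show Tendsto q (𝓝[>] (0 : ℝ)) (𝓝 d) from hd).comp (tendsto_fst (g := 𝓝 d)))
    simpa using this
  have hb : Tendsto (fun p : ℝ × (Fin n → ℝ) => √((p.2 - q p.1) ⬝ᵥ (p.2 - q p.1)))
      (𝓝[>] (0 : ℝ) ×ˢ 𝓝 d) (𝓝 0) := by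
    have hc : Continuous fun e : Fin n → ℝ => √(e ⬝ᵥ e) := by
      simp only [dotProduct]
      fun_prop
    have := (hc.tendsto 0).comp he
    simpa only [Function.comp_def, dotProduct_zero, Real.sqrt_zero] using this
  have hR : Tendsto (fun p : ℝ × (Fin n → ℝ) => U p.1 * rdiag m (p.2 - q p.1) * (V p.1)ᵀ)
      (𝓝[>] (0 : ℝ) ×ˢ 𝓝 d) (𝓝 0) := by
    refine tendsto_matrix_of_apply fun i j => squeeze_zero_norm (fun p => ?_) hb
    refine Real.abs_le_sqrt ((sq_apply_le_matInner_self _ i j).trans_eq ?_)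
    rw [matInner_conj_self (hU _) (hV _), matInner_rdiag_rdiag hmn]
  have hadd := hR.const_add H
  rw [add_zero] at hadd
  refine hadd.congr' ?_
  filter_upwards [tendsto_fst.eventually (self_mem_nhdsWithin (a := (0 : ℝ)) (s := Set.Ioi 0))]
    with p hp
  have hp0 : p.1 ≠ 0 := ne_of_gt hp
  have e1 : sing X + p.1 • p.2 = sing (X + p.1 • H) + p.1 • (p.2 - q p.1) := by
    simp only [hq, smul_sub, smul_smul, mul_inv_cancel₀ hp0, one_smul]
    abel
  rw [e1, rdiag_add_smul, Matrix.mul_add, Matrix.add_mul, ← Sig, ← hX, Matrix.mul_smul,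
    Matrix.smul_mul, add_assoc, add_sub_cancel_left, ← smul_add, smul_smul, inv_mul_cancel₀ hp0,
    one_smul]

/-- The chain rule for the subderivative of `f ∘ σ`. -/
theorem subderivative_comp_sing (hmn : n ≤ m) {f : (Fin n → ℝ) → EReal}
    (hf : AbsolutelySymmetric f) {X H : Matrix (Fin m) (Fin n) ℝ} {d : Fin n → ℝ}
    (hd : HasDirDeriv sing X H d) :
    subderivative (f ∘ sing) X H = subderivative f (sing X) d := by
  have hpos : ∀ {E : Type} (l : Filter E), ∀ᶠ p in (𝓝[>] (0 : ℝ)) ×ˢ l, (0 : ℝ) < p.1 :=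
    fun l => tendsto_fst.eventually (self_mem_nhdsWithin (a := (0 : ℝ)) (s := Set.Ioi 0))
  refine le_antisymm ?_ ?_
  -- For `≤`, vector directions are lifted to matrices; for `≥` below, matrix directions are pushed
  -- down by `σ`. Either map preserves the difference quotients, and a lower limit along a finer
  -- filter is no smaller.
  · choose U hU V hV hX using fun t : ℝ => exists_svd hmn (X + t • H)
    have hlim := (tendsto_fst (f := 𝓝[>] (0 : ℝ)) (g := 𝓝 d)).prodMk
      (tendsto_conj_rdiag_quotient hmn hd hU hV hX)
    refine (liminf_le_liminf_of_le hlim).trans_eq ?_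
    rw [← liminf_comp]
    refine liminf_congr ?_
    filter_upwards [hpos (𝓝 d)] with p hp
    simp only [Function.comp_apply]
    rw [smul_smul, mul_inv_cancel₀ hp.ne', one_smul, add_sub_cancel,
      apply_sing_conj_rdiag hmn hf (hU _) (hV _)]
  · have hlim := (tendsto_fst (f := 𝓝[>] (0 : ℝ)) (g := 𝓝 H)).prodMk
      (tendsto_sing_quotient hmn hd)
    refine (liminf_le_liminf_of_le hlim).trans_eq ?_
    rw [← liminf_comp]
    refine liminf_congr ?_
    filter_upwards [hpos (𝓝 H)] with p hp
    simp only [Function.comp_apply]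
    rw [smul_smul, mul_inv_cancel₀ hp.ne', one_smul, add_sub_cancel]

end Symmetric

/-! ### Subgradients -/

section Subgradient

variable {m n : ℕ}

theorem EReal_le_zero_of_add_le {a : EReal} {b : ℝ} (h1 : a ≠ ⊥) (h2 : a ≠ ⊤)
    (h : a + (b : EReal) ≤ a) : b ≤ 0 := by
  lift a to ℝ using ⟨h2, h1⟩
  norm_cast at h
  linarith

/-- A subgradient of `f ∘ σ` at `X` has a simultaneous singular value decomposition with `X`,
and its singular values form a subgradient of `f`. -/
theorem subdifferential_comp_sing (hmn : n ≤ m) {f : (Fin n → ℝ) → EReal}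
    (hf : AbsolutelySymmetric f) {X Y : Matrix (Fin m) (Fin n) ℝ}
    (hY : Y ∈ subdifferential matInner (f ∘ sing) X) :
    SimulOrderedSVD X Y ∧ sing Y ∈ subdifferential dotProduct f (sing X) := by
  obtain ⟨hbot, htop, hsub⟩ := hY
  have heq : matInner X Y = sing X ⬝ᵥ sing Y := by
    refine le_antisymm (matInner_le_sing hmn X Y) ?_
    obtain ⟨U, hU, V, hV, hYsvd⟩ := exists_svd hmn Y
    -- This test point has the singular values of `X`, hence the same value of `f ∘ σ`, and pairs
    -- with `Y` to `σ(Y) ⬝ᵥ σ(X)`.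
    have h1 := hsub (U * Sig X * Vᵀ)
    have h2 : sing (U * Sig X * Vᵀ) = sing X :=
      sing_conj_rdiag hmn hU hV (sing_antitone X) (sing_nonneg X)
    rw [Function.comp_apply, Function.comp_apply, h2] at h1
    have h3 := EReal_le_zero_of_add_le hbot htop h1
    have h4 := matInner_conj_self hU hV (Sig Y) (Sig X)
    rw [← hYsvd, Sig, Sig, matInner_rdiag_rdiag hmn, dotProduct_comm, ← Sig] at h4
    rw [matInner_sub_right, h4, matInner_comm Y X] at h3
    linarith
  have hsim := simulOrderedSVD_of_matInner_eq hmn heq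
  refine ⟨hsim, hbot, htop, fun z => ?_⟩
  obtain ⟨⟨U, V⟩, ⟨hU, hV, hXsvd⟩, ⟨-, -, hYsvd⟩⟩ := hsim
  change X = U * Sig X * Vᵀ at hXsvd
  change Y = U * Sig Y * Vᵀ at hYsvd
  change U ∈ _ at hU
  change V ∈ _ at hV
  -- In the common decomposition, diagonal test matrices turn the subgradient inequality for `f ∘ σ`
  -- into the one for `f`.
  have h1 := hsub (U * rdiag m z * Vᵀ)
  have h2 := matInner_conj_self hU hV (Sig Y) (rdiag m z)
  rw [← hYsvd, Sig, matInner_rdiag_rdiag hmn] at h2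
  rw [Function.comp_apply, Function.comp_apply, apply_sing_conj_rdiag hmn hf hU hV,
    matInner_sub_right, h2, matInner_comm Y X, heq, dotProduct_comm (sing X)] at h1
  rwa [dotProduct_sub]

theorem le_subderivative_of_mem_subdifferential {f : (Fin n → ℝ) → EReal} {x v : Fin n → ℝ}
    (hv : v ∈ subdifferential dotProduct f x) (w : Fin n → ℝ) :
    ((v ⬝ᵥ w : ℝ) : EReal) ≤ subderivative f x w := by
  obtain ⟨hbot, htop, hsub⟩ := hv
  have hlim : Tendsto (fun p : ℝ × (Fin n → ℝ) => ((v ⬝ᵥ p.2 : ℝ) : EReal))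
      (𝓝[>] (0 : ℝ) ×ˢ 𝓝 w) (𝓝 ((v ⬝ᵥ w : ℝ) : EReal)) := by
    have hc : Continuous fun w : Fin n → ℝ => ((v ⬝ᵥ w : ℝ) : EReal) := by
      have h0 : Continuous fun w : Fin n → ℝ => v ⬝ᵥ w := by
        simp only [dotProduct]
        fun_prop
      exact continuous_coe_real_ereal.comp h0
    exact (hc.tendsto w).comp tendsto_snd
  rw [← hlim.liminf_eq]
  refine liminf_le_liminf ?_
  filter_upwards [tendsto_fst.eventually (self_mem_nhdsWithin (a := (0 : ℝ)) (s := Set.Ioi 0))]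
    with p hp
  have hp : 0 < p.1 := hp
  have h := hsub (x + p.1 • p.2)
  rw [add_sub_cancel_left, dotProduct_smul, smul_eq_mul] at h
  rw [EReal.le_div_iff_mul_le (by exact_mod_cast hp) (EReal.coe_ne_top _),
    EReal.le_sub_iff_add_le (Or.inl hbot) (Or.inl htop), ← EReal.coe_mul, mul_comm (v ⬝ᵥ p.2),
    add_comm]
  exact h

end Subgradient

/-! ### The critical cone -/

section Cone

variable {m n : ℕ}

theorem sum_eq_sum_alphaIdx_add_sum_betaIdx {X : Matrix (Fin m) (Fin n) ℝ} {t : ℕ}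
    {μ : Fin t → ℝ} (hμ : StrictAnti μ)
    (hrange : Set.range μ = {c : ℝ | c ≠ 0 ∧ ∃ s, sing X s = c}) (g : Fin n → ℝ) :
    ∑ s, g s = ∑ i, ∑ s ∈ alphaIdx X (μ i), g s + ∑ s ∈ betaIdx X, g s := by
  classical
  have hμ0 : ∀ i, μ i ≠ 0 := fun i =>
    (hrange ▸ Set.mem_range_self i : μ i ∈ {c : ℝ | c ≠ 0 ∧ ∃ s, sing X s = c}).1
  have e1 : ∀ i, ∑ s ∈ alphaIdx X (μ i), g s = ∑ s, if sing X s = μ i then g s else 0 := fun i => by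
    rw [← Finset.sum_filter]
    refine Finset.sum_congr ?_ fun _ _ => rfl
    ext s
    simp [mem_alphaIdx (hμ0 i)]
  have e2 : ∑ s ∈ betaIdx X, g s = ∑ s, if sing X s = 0 then g s else 0 := by
    rw [← Finset.sum_filter]
    refine Finset.sum_congr ?_ fun _ _ => rfl
    ext s
    simp [mem_betaIdx]
  simp only [e1, e2]
  rw [Finset.sum_comm, ← Finset.sum_add_distrib]
  refine Finset.sum_congr rfl fun s _ => ?_
  by_cases hs : sing X s = 0
  · simp [hs, fun i => (hμ0 i).symm]
  · obtain ⟨i, hi⟩ : sing X s ∈ Set.range μ := by rw [hrange]; exact ⟨hs, s, rfl⟩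
    rw [Finset.sum_eq_single i (fun j _ hj => if_neg fun h => hj (hμ.injective (h.symm.trans hi.symm)))
      (by simp), if_pos hi.symm, if_neg hs, add_zero]

theorem Sig_submatrix_alphaIdx (hmn : n ≤ m) (Y : Matrix (Fin m) (Fin n) ℝ) (I : Finset (Fin n)) :
    (Sig Y).submatrix (rowEnum hmn I) (enum I) = diagonal (sing Y ∘ enum I) := by
  ext a b
  simp only [submatrix_apply, Sig, rowEnum, Function.comp_apply, rdiag_castLE, diagonal_apply,
    (enum_injective I).eq_iff]
  split_ifs with h
  · rw [h]
  · rfl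

theorem eigs_Sig_submatrix (hmn : n ≤ m) (Y : Matrix (Fin m) (Fin n) ℝ) (I : Finset (Fin n)) :
    eigs ((Sig Y).submatrix (rowEnum hmn I) (enum I)) = sing Y ∘ enum I := by
  have := eigs_conj_diagonal (W := 1) (one_mem _) (a := sing Y ∘ enum I)
    ((sing_antitone Y).comp_monotone (enum_strictMono I).monotone)
  rwa [transpose_one, Matrix.one_mul, Matrix.mul_one, ← Sig_submatrix_alphaIdx hmn] at this

theorem matInner_symBlock (hmn : n ≤ m) (Y H : Matrix (Fin m) (Fin n) ℝ)
    (U : Matrix (Fin m) (Fin m) ℝ) (V : Matrix (Fin n) (Fin n) ℝ) (I : Finset (Fin n)) :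
    matInner ((Sig Y).submatrix (rowEnum hmn I) (enum I)) (symBlock hmn U V H I) =
      ∑ s ∈ I, sing Y s * (Uᵀ * H * V) (Fin.castLE hmn s) s := by
  rw [Sig_submatrix_alphaIdx, ← rdiag_square, matInner_rdiag_left le_rfl,
    ← sum_enum I fun s => sing Y s * (Uᵀ * H * V) (Fin.castLE hmn s) s]
  refine Finset.sum_congr rfl fun a _ => ?_
  rw [show Fin.castLE le_rfl a = a from rfl, symBlock_apply, Function.comp_apply]
  ring

theorem sing_Sig_submatrix_beta (hmn : n ≤ m) (X Y : Matrix (Fin m) (Fin n) ℝ) :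
    sing ((Sig Y).submatrix (enum (betaHatIdx X)) (enum (betaIdx X))) =
      sing Y ∘ enum (betaIdx X) := by
  have := sing_conj_rdiag (U := 1) (V := 1) (card_betaIdx_le hmn X) (one_mem _) (one_mem _)
    (a := sing Y ∘ enum (betaIdx X))
    ((sing_antitone Y).comp_monotone (enum_strictMono _).monotone) (fun _ => sing_nonneg _ _)
  rwa [transpose_one, Matrix.one_mul, Matrix.mul_one, ← rdiag_submatrix_beta, ← Sig] at this

theorem matInner_beta_block (hmn : n ≤ m) (X Y M : Matrix (Fin m) (Fin n) ℝ) :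
    matInner ((Sig Y).submatrix (enum (betaHatIdx X)) (enum (betaIdx X)))
      (M.submatrix (enum (betaHatIdx X)) (enum (betaIdx X))) =
      ∑ s ∈ betaIdx X, sing Y s * M (Fin.castLE hmn s) s := by
  rw [Sig, rdiag_submatrix_beta, matInner_rdiag_left (card_betaIdx_le hmn X),
    ← sum_enum (betaIdx X) fun s => sing Y s * M (Fin.castLE hmn s) s]
  refine Finset.sum_congr rfl fun a _ => ?_
  -- Both enumerations start at `X.rank` and run through consecutive indices, so the diagonal of the
  -- block lies on the diagonal of the matrix.
  have : enum (betaHatIdx X) (Fin.castLE (card_betaIdx_le hmn X) a) =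
      Fin.castLE hmn (enum (betaIdx X) a) := by
    have h1 : (enum (betaHatIdx X) (Fin.castLE (card_betaIdx_le hmn X) a) : ℕ) = X.rank + a :=
      enum_filter_le_val X.rank _
    have h2 : (enum (betaIdx X) a : ℕ) = X.rank + a := enum_filter_le_val X.rank a
    exact Fin.ext (h1.trans h2.symm)
  rw [submatrix_apply, this, Function.comp_apply]

/-- `⟨Y, H⟩ ≤ ⟨σ(Y), σ'(X; H)⟩`, with equality exactly when all the blocks have simultaneous
ordered decompositions. -/
theorem matInner_le_and_eq_iff (hmn : n ≤ m) {X Y H : Matrix (Fin m) (Fin n) ℝ} {t : ℕ}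
    {μ : Fin t → ℝ} (hμ : StrictAnti μ)
    (hrange : Set.range μ = {c : ℝ | c ≠ 0 ∧ ∃ s, sing X s = c}) {d : Fin n → ℝ}
    (hd : IsSpectralDerivative hmn X H d)
    {U : Matrix (Fin m) (Fin m) ℝ} {V : Matrix (Fin n) (Fin n) ℝ}
    (hU : U ∈ Matrix.orthogonalGroup (Fin m) ℝ) (hV : V ∈ Matrix.orthogonalGroup (Fin n) ℝ)
    (hX : X = U * Sig X * Vᵀ) (hY : Y = U * Sig Y * Vᵀ) :
    matInner Y H ≤ sing Y ⬝ᵥ d ∧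
    (matInner Y H = sing Y ⬝ᵥ d ↔
      (∀ i : Fin t,
        SimulOrderedSpectral
          ((Sig Y).submatrix (rowEnum hmn (alphaIdx X (μ i))) (enum (alphaIdx X (μ i))))
          (symBlock hmn U V H (alphaIdx X (μ i)))) ∧
      SimulOrderedSVD
        ((Sig Y).submatrix (enum (betaHatIdx X)) (enum (betaIdx X)))
        ((Uᵀ * H * V).submatrix (enum (betaHatIdx X)) (enum (betaIdx X)))) := by
  have hμ0 : ∀ i, μ i ≠ 0 := fun i =>
    (hrange ▸ Set.mem_range_self i : μ i ∈ {c : ℝ | c ≠ 0 ∧ ∃ s, sing X s = c}).1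
  obtain ⟨hα, hβ⟩ := hd.blocks hmn hU hV hX
  have hYH : matInner Y H = ∑ s, sing Y s * (Uᵀ * H * V) (Fin.castLE hmn s) s := by
    conv_lhs => rw [hY, matInner_mul_mul, Sig, matInner_rdiag_left hmn]
  have hAsym : ∀ I : Finset (Fin n), ((Sig Y).submatrix (rowEnum hmn I) (enum I))ᵀ =
      (Sig Y).submatrix (rowEnum hmn I) (enum I) := fun I => by
    rw [Sig_submatrix_alphaIdx, diagonal_transpose]
  have hA : ∀ i, eigs ((Sig Y).submatrix (rowEnum hmn (alphaIdx X (μ i)))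
      (enum (alphaIdx X (μ i)))) ⬝ᵥ eigs (symBlock hmn U V H (alphaIdx X (μ i))) =
      ∑ s ∈ alphaIdx X (μ i), sing Y s * d s := fun i => by
    rw [hα _ (hμ0 i), eigs_Sig_submatrix]
    exact sum_enum (alphaIdx X (μ i)) fun s => sing Y s * d s
  have hB : sing ((Sig Y).submatrix (enum (betaHatIdx X)) (enum (betaIdx X))) ⬝ᵥ
      sing ((Uᵀ * H * V).submatrix (enum (betaHatIdx X)) (enum (betaIdx X))) =
      ∑ s ∈ betaIdx X, sing Y s * d s := by
    rw [hβ, sing_Sig_submatrix_beta hmn]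
    exact sum_enum (betaIdx X) fun s => sing Y s * d s
  have hAle : ∀ i, ∑ s ∈ alphaIdx X (μ i), sing Y s * (Uᵀ * H * V) (Fin.castLE hmn s) s ≤
      ∑ s ∈ alphaIdx X (μ i), sing Y s * d s := fun i => by
    rw [← matInner_symBlock, ← hA]
    exact matInner_le_eigs (hAsym _) (symBlock_transpose _ _ _ _ _)
  have hBle : ∑ s ∈ betaIdx X, sing Y s * (Uᵀ * H * V) (Fin.castLE hmn s) s ≤
      ∑ s ∈ betaIdx X, sing Y s * d s := by
    rw [← matInner_beta_block, ← hB]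
    exact matInner_le_sing (card_betaIdx_le hmn X) _ _
  have hAsum := Finset.sum_le_sum fun i (_ : i ∈ Finset.univ) => hAle i
  rw [hYH, dotProduct, sum_eq_sum_alphaIdx_add_sum_betaIdx hμ hrange,
    sum_eq_sum_alphaIdx_add_sum_betaIdx hμ hrange fun s => sing Y s * d s]
  refine ⟨add_le_add hAsum hBle, fun h => ⟨fun i => ?_, ?_⟩, fun ⟨h1, h2⟩ => ?_⟩
  -- Equal totals of termwise ordered sums force equality in every block.
  · have hsum := le_antisymm hAsum (by linarith)
    have := (Finset.sum_eq_sum_iff_of_le fun i _ => hAle i).mp hsum i (Finset.mem_univ i)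
    refine simulOrderedSpectral_of_matInner_eq (hAsym _) (symBlock_transpose _ _ _ _ _) ?_
    rw [matInner_symBlock, hA, this]
  · refine simulOrderedSVD_of_matInner_eq (card_betaIdx_le hmn X) ?_
    rw [matInner_beta_block hmn, hB]
    linarith
  · congr 1
    · refine Finset.sum_congr rfl fun i _ => ?_
      rw [← matInner_symBlock, ← hA]
      exact matInner_eq_of_simulOrderedSpectral (h1 i)
    · rw [← matInner_beta_block, ← hB]
      exact matInner_eq_of_simulOrderedSVD (card_betaIdx_le hmn X) h2

end Cone

end CritCone

/-! ### The characterization of critical directions. -/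

open CritCone in
theorem mainTheorem10 {m n : ℕ} (hmn : n ≤ m)
    (f : (Fin n → ℝ) → EReal)
    (hf_lsc : LowerSemicontinuous f)
    (hf_conv : Convex ℝ (epigraph f))
    (hf_symm : AbsolutelySymmetric f)
    (X Y H : Matrix (Fin m) (Fin n) ℝ)
    {t : ℕ} (μ : Fin t → ℝ) (hμ_anti : StrictAnti μ)
    (hμ_range : Set.range μ = {c : ℝ | c ≠ 0 ∧ ∃ s, sing X s = c})
    (hY : Y ∈ subdifferential matInner (f ∘ sing) X) :
    (svdPairs X ∩ svdPairs Y).Nonempty ∧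
    ∃ d : Fin n → ℝ, HasDirDeriv sing X H d ∧
      ∀ (U : Matrix (Fin m) (Fin m) ℝ) (V : Matrix (Fin n) (Fin n) ℝ),
        (U, V) ∈ svdPairs X ∩ svdPairs Y →
          (H ∈ criticalCone matInner (f ∘ sing) X Y ↔
            d ∈ criticalCone dotProduct f (sing X) (sing Y) ∧
            (∀ i : Fin t,
              SimulOrderedSpectral
                ((Sig Y).submatrix (rowEnum hmn (alphaIdx X (μ i))) (enum (alphaIdx X (μ i))))
                (symBlock hmn U V H (alphaIdx X (μ i)))) ∧
            SimulOrderedSVD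
              ((Sig Y).submatrix (enum (betaHatIdx X)) (enum (betaIdx X)))
              ((cols U (enum (betaHatIdx X)))ᵀ * H * cols V (enum (betaIdx X)))) := by
  obtain ⟨hsim, hsub⟩ := subdifferential_comp_sing hmn hf_symm hY
  obtain ⟨d, hdir, hd⟩ := exists_hasDirDeriv_sing hmn X H
  refine ⟨hsim, d, hdir, fun U V hUV => ?_⟩
  obtain ⟨⟨hU, hV, hX⟩, ⟨-, -, hYs⟩⟩ := hUV
  obtain ⟨hle, hiff⟩ := matInner_le_and_eq_iff hmn hμ_anti hμ_range hd hU hV hX hYs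
  have hsd := le_subderivative_of_mem_subdifferential hsub d
  have hD : (cols U (enum (betaHatIdx X)))ᵀ * H * cols V (enum (betaIdx X)) =
      (Uᵀ * H * V).submatrix (enum (betaHatIdx X)) (enum (betaIdx X)) := rfl
  rw [hD, ← hiff]
  simp only [criticalCone, Set.mem_ofPred_eq]
  rw [subderivative_comp_sing hmn hf_symm hdir]
  constructor
  -- Criticality turns the subgradient bound into `⟨σ(Y), d⟩ ≤ ⟨Y, H⟩`, the reverse of the block
  -- inequality.
  · intro h
    rw [h, EReal.coe_le_coe_iff] at hsd
    have heq := le_antisymm hle hsd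
    exact ⟨by rw [h, heq], heq⟩
  · rintro ⟨h, heq⟩
    rw [h, heq]
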